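/- Let $A_1,\dots,A_m\in\mathbb R^{n\times n}$, let $\mathcal A:\mathbb R^{n\times n}\to\mathbb R^m$ be given by $\mathcal A(M)=(\langle A_1,M\rangle,\dots,\langle A_m,M\rangle)^\top$ with $\langle A,M\rangle=\operatorname{tr}(A^\top M)$, and let $\mathbf A=[\operatorname{vec}(A_1),\dots,\operatorname{vec}(A_m)]^\top\in\mathbb R^{m\times n^2}$. Let $r\ge r^*\ge 1$ be integers, let $M^*\in\mathbb R^{n\times n}$ be symmetric positive semidefinite of rank $r^*$, let $w$ be a random vector in $\mathbb R^m$, and put $$f(X)=\tfrac12\|\mathcal A(XX^\top)-\mathcal A(M^*)+w\|^2,\qquad X\in\mathbb R^{n\times r}.$$ Assume that $\mathcal A$ satisfies the $(\delta,r+r^*)$-RIP property, i.e. $\delta\in[0,1)$ and $(1-\delta)\|M\|_F^2\le\|\mathcal A(M)\|^2\le(1+\delta)\|M\|_F^2$ for all $M\in\mathbb R^{n\times n}$ with $\operatorname{rank}(M)\le r+r^*$, and that $\delta<1/(1+\sqrt{r^*/r})$. Then for every $\epsilon>0$ and $\kappa\ge0$, with probability at least $\mathbb P(\|\mathbf A^\top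 w\|\le\epsilon)$, the following holds for every $\hat X\in\mathbb R^{n\times r}$ satisfying $$\|\nabla f(\hat X)\|_F\le\kappa\|\hat X\|_2,\qquad \nabla^2 f(\hat X)\succeq-\kappa I_{nr}.$$ If $\sigma_r(\hat X)\le\sqrt{\frac{\epsilon+\kappa/2}{1+\delta}}$, then $$\|\hat X\hat X^\top-M^*\|_F\le\frac{(\epsilon+\kappa/2)\sqrt r+\sqrt{(\epsilon+\kappa/2)^2r+16(1-\delta)(\epsilon+\kappa/2)\sqrt r\,\|M^*\|_F}}{2(1-\delta)};$$ and if $\sigma_r(\hat X)>\sqrt{\frac{\epsilon+\kappa/2}{1+\delta}}$, then $$\left(\frac{1-\delta}{1+\delta}-\frac{\sqrt{r^*/r}}{2+\sqrt{r^*/r}}\right)\|\hat X\hat X^\top-M^*\|_F\le(2\epsilon+\kappa)\sqrt{r^*}+2\sqrt{(2\epsilon+\kappa)(1+\delta)}\left(\|\hat X\hat X^\top-M^*\|_F^{1/2}+\|M^*\|_F^{1/2}\right).$$ Here $\|\cdot\|_F$ and $\|\cdot\|_2$ are the Frobenius and spectral norms, $\sigma_r(\hat X)$ is the $r$-th largest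 singular value of $\hat X$ (zero if $r>n$), and $\nabla^2 f(\hat X)$ is the $nr\times nr$ matrix of second partial derivatives. -/

import Mathlib

open MeasureTheory

namespace MatrixSensing

/-- The Frobenius norm `‖M‖_F`. -/
noncomputable def frobNorm {p q : ℕ} (M : Matrix (Fin p) (Fin q) ℝ) : ℝ :=
  Real.sqrt (∑ i, ∑ j, M i j ^ 2)

open scoped Matrix.Norms.L2Operator in
/-- The spectral norm `‖M‖₂` (the norm induced by the Euclidean norms). -/
noncomputable def specNorm {p q : ℕ} (M : Matrix (Fin p) (Fin q) ℝ) : ℝ := ‖M‖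

/-- `σ_k(M)`, the `k`-th largest singular value, counted from `k = 1` (Mathlib counts from `0`);
it is zero when `k` exceeds the number of rows or columns. -/
noncomputable def sigma {p q : ℕ} (M : Matrix (Fin p) (Fin q) ℝ) (k : ℕ) : ℝ :=
  (Matrix.toLpLin 2 2 M).singularValues (k - 1)

/-- The measurement operator `𝒜(M) = (⟨A₁, M⟩, …, ⟨A_m, M⟩)`, where `⟨A, M⟩ = tr(Aᵀ M)`. -/
noncomputable def sensing {m n : ℕ} (A : Fin m → Matrix (Fin n) (Fin n) ℝ)
    (M : Matrix (Fin n) (Fin n) ℝ) : EuclideanSpace ℝ (Fin m) :=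
  WithLp.toLp 2 fun i => ((A i).transpose * M).trace

/-- The matrix representation `𝐀` of the measurement operator, with rows `vec(A_i)ᵀ`. -/
def sensingMatrix {m n : ℕ} (A : Fin m → Matrix (Fin n) (Fin n) ℝ) :
    Matrix (Fin m) (Fin n × Fin n) ℝ :=
  Matrix.of fun i => Matrix.vec (A i)

/-- The `(δ, g)` restricted isometry property of the measurement operator. -/
def HasRIP {m n : ℕ} (A : Fin m → Matrix (Fin n) (Fin n) ℝ) (δ : ℝ) (g : ℕ) : Prop :=
  0 ≤ δ ∧ δ < 1 ∧ ∀ M : Matrix (Fin n) (Fin n) ℝ, M.rank ≤ g →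
    (1 - δ) * frobNorm M ^ 2 ≤ ‖sensing A M‖ ^ 2 ∧
      ‖sensing A M‖ ^ 2 ≤ (1 + δ) * frobNorm M ^ 2

/-- The objective `f(X) = ½ ‖𝒜(X Xᵀ) - b + w‖²` with `b = 𝒜(M*)`. -/
noncomputable def objective {m n r : ℕ} (A : Fin m → Matrix (Fin n) (Fin n) ℝ)
    (Mstar : Matrix (Fin n) (Fin n) ℝ) (w : EuclideanSpace ℝ (Fin m))
    (X : Matrix (Fin n) (Fin r) ℝ) : ℝ :=
  1 / 2 * ‖sensing A (X * X.transpose) - sensing A Mstar + w‖ ^ 2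

/-- The partial derivative `∂F/∂X_{ij}` of a real function of a matrix. -/
noncomputable def partialDeriv {n r : ℕ} (F : Matrix (Fin n) (Fin r) ℝ → ℝ)
    (i : Fin n) (j : Fin r) (X : Matrix (Fin n) (Fin r) ℝ) : ℝ :=
  lineDeriv ℝ F X (Matrix.single i j 1)

/-- The gradient `∇F(X)`, as the matrix of partial derivatives. -/
noncomputable def grad {n r : ℕ} (F : Matrix (Fin n) (Fin r) ℝ → ℝ)
    (X : Matrix (Fin n) (Fin r) ℝ) : Matrix (Fin n) (Fin r) ℝ :=
  Matrix.of fun i j => partialDeriv F i j X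

/-- The Hessian `∇²F(X)` in matrix form: its entry at the positions of `X_{ij}` and `X_{kl}` in
the column-stacking vectorization is `∂²F/∂X_{ij}∂X_{kl}`.  (`Matrix.vec` puts `X_{ij}` at
position `(j, i)`.) -/
noncomputable def hess {n r : ℕ} (F : Matrix (Fin n) (Fin r) ℝ → ℝ)
    (X : Matrix (Fin n) (Fin r) ℝ) : Matrix (Fin r × Fin n) (Fin r × Fin n) ℝ :=
  Matrix.of fun p q => partialDeriv (partialDeriv F q.2 q.1) p.2 p.1 X

/-- Approximate second-order critical points: `‖∇F(X)‖ ≤ κ ‖X‖₂` and `∇²F(X) ⪰ -κ I`. -/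
def IsApproxSecondOrder {n r : ℕ} (F : Matrix (Fin n) (Fin r) ℝ → ℝ) (κ : ℝ)
    (X : Matrix (Fin n) (Fin r) ℝ) : Prop :=
  frobNorm (grad F X) ≤ κ * specNorm X ∧
    (hess F X + κ • (1 : Matrix (Fin r × Fin n) (Fin r × Fin n) ℝ)).PosSemidef

end MatrixSensing

namespace MatrixSensing

open Matrix

/-! On the event `‖𝐀ᵀw‖ ≤ ε` the argument is deterministic. Write `E = XXᵀ - M*`, `M* = BBᵀ`, `η = ε
+ κ/2` and `σ = σ_r(X)`. Noise changes the residual pairing with `𝒜(M)` by at most `ε‖M‖_F`.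
Stationarity therefore makes `⟨𝒜E, 𝒜(XUᵀ + UXᵀ)⟩` small. The Hessian, tested on directions `a uᵀ`
with `u` a unit right singular vector for `σ`, bounds `-⟨𝒜E, 𝒜(VVᵀ)⟩` in terms of `σ²`
(`neg_inner_le`).

If `σ` is small, expand `⟨𝒜E, 𝒜E⟩` along `E = XXᵀ - BBᵀ`: the first-order bound with `U = X` and the
curvature bound with `V = B` give a quadratic inequality for `‖E‖_F`.

If `σ` is large, `X` has full column rank. Let `P` project onto its range, and put `V = (1 - P)B`,
`W = VVᵀ`, `F = E + W`. Then `F ⊥ W`, and `F = XUᵀ + UXᵀ` with `U` controlled by `F/σ`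
(`exists_symProd_eq`), so stationarity handles `F` and curvature handles `W`. Polarized RIP
(`HasRIP.le_inner`) is applied to `E` and a test matrix `D = (1 + ρ)F - bW`, `ρ = √(r*/r)`. A
suitable `b` exists (`exists_certificate_coeff`) because `‖F‖_F` is bounded below in terms of `σ`
and `V` (`le_frobNorm_tangent_sq`); the `r - r*` surplus dimensions of `X` enter there. `gap_mul_le`
assembles the estimate. -/

/-- The Frobenius inner product `⟨M, N⟩ = tr(Mᵀ N)`. -/
def frobInner {p q : ℕ} (M N : Matrix (Fin p) (Fin q) ℝ) : ℝ := (Mᵀ * N).trace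

/-- Vectorization into Euclidean space. -/
def euclVec {p q : ℕ} (M : Matrix (Fin p) (Fin q) ℝ) : EuclideanSpace ℝ (Fin q × Fin p) :=
  WithLp.toLp 2 M.vec

/-! ### Frobenius and spectral norms -/

section Frobenius

variable {p q s : ℕ}

theorem frobInner_eq_inner (M N : Matrix (Fin p) (Fin q) ℝ) :
    frobInner M N = inner ℝ (euclVec M) (euclVec N) := by
  rw [frobInner, ← vec_dotProduct_vec, EuclideanSpace.inner_eq_star_dotProduct]
  simp [euclVec, dotProduct_comm]

theorem frobNorm_eq_norm (M : Matrix (Fin p) (Fin q) ℝ) : frobNorm M = ‖euclVec M‖ := by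
  rw [frobNorm, EuclideanSpace.norm_eq, Fintype.sum_prod_type, Finset.sum_comm]
  simp [euclVec, vec]

theorem frobNorm_nonneg (M : Matrix (Fin p) (Fin q) ℝ) : 0 ≤ frobNorm M := Real.sqrt_nonneg _

theorem frobInner_self (M : Matrix (Fin p) (Fin q) ℝ) : frobInner M M = frobNorm M ^ 2 := by
  rw [frobInner_eq_inner, frobNorm_eq_norm, real_inner_self_eq_norm_sq]

theorem frobInner_comm (M N : Matrix (Fin p) (Fin q) ℝ) : frobInner M N = frobInner N M := by
  rw [frobInner_eq_inner, frobInner_eq_inner, real_inner_comm]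

theorem frobInner_add_left (M N K : Matrix (Fin p) (Fin q) ℝ) :
    frobInner (M + N) K = frobInner M K + frobInner N K := by
  simp [frobInner, Matrix.add_mul]

theorem frobInner_add_right (M N K : Matrix (Fin p) (Fin q) ℝ) :
    frobInner M (N + K) = frobInner M N + frobInner M K := by
  simp [frobInner, Matrix.mul_add]

theorem frobInner_sub_left (M N K : Matrix (Fin p) (Fin q) ℝ) :
    frobInner (M - N) K = frobInner M K - frobInner N K := by
  simp [frobInner, Matrix.sub_mul]

theorem frobInner_sub_right (M N K : Matrix (Fin p) (Fin q) ℝ) :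
    frobInner M (N - K) = frobInner M N - frobInner M K := by
  simp [frobInner, Matrix.mul_sub]

theorem frobInner_smul_left (c : ℝ) (M N : Matrix (Fin p) (Fin q) ℝ) :
    frobInner (c • M) N = c * frobInner M N := by
  simp [frobInner]

theorem frobInner_smul_right (c : ℝ) (M N : Matrix (Fin p) (Fin q) ℝ) :
    frobInner M (c • N) = c * frobInner M N := by
  simp [frobInner]

theorem frobInner_mul_left (M : Matrix (Fin p) (Fin s) ℝ) (N : Matrix (Fin s) (Fin q) ℝ)
    (K : Matrix (Fin p) (Fin q) ℝ) : frobInner (M * N) K = frobInner N (Mᵀ * K) := by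
  simp [frobInner, Matrix.mul_assoc]

theorem frobInner_mul_left' (M : Matrix (Fin p) (Fin s) ℝ) (N : Matrix (Fin s) (Fin q) ℝ)
    (K : Matrix (Fin p) (Fin q) ℝ) : frobInner (M * N) K = frobInner M (K * Nᵀ) := by
  rw [frobInner, frobInner, transpose_mul, Matrix.mul_assoc, trace_mul_comm, Matrix.mul_assoc]

theorem frobNorm_transpose (M : Matrix (Fin p) (Fin q) ℝ) : frobNorm Mᵀ = frobNorm M := by
  rw [frobNorm, frobNorm, Finset.sum_comm]; rfl

theorem abs_frobInner_le (M N : Matrix (Fin p) (Fin q) ℝ) :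
    |frobInner M N| ≤ frobNorm M * frobNorm N := by
  rw [frobInner_eq_inner, frobNorm_eq_norm, frobNorm_eq_norm]
  exact abs_real_inner_le_norm _ _

theorem frobInner_le (M N : Matrix (Fin p) (Fin q) ℝ) :
    frobInner M N ≤ frobNorm M * frobNorm N :=
  (le_abs_self _).trans (abs_frobInner_le M N)

theorem frobNorm_add_le (M N : Matrix (Fin p) (Fin q) ℝ) :
    frobNorm (M + N) ≤ frobNorm M + frobNorm N := by
  simp only [frobNorm_eq_norm]
  exact norm_add_le (euclVec M) (euclVec N)

theorem frobNorm_smul (c : ℝ) (M : Matrix (Fin p) (Fin q) ℝ) :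
    frobNorm (c • M) = |c| * frobNorm M := by
  simp only [frobNorm_eq_norm]
  exact norm_smul c (euclVec M)

theorem eq_zero_of_frobNorm_eq_zero {M : Matrix (Fin p) (Fin q) ℝ} (h : frobNorm M = 0) :
    M = 0 := by
  rw [frobNorm_eq_norm, norm_eq_zero] at h
  exact vec_eq_zero_iff.1 (congrArg WithLp.ofLp h)

theorem frobNorm_sq_eq_sum_col (M : Matrix (Fin p) (Fin q) ℝ) :
    frobNorm M ^ 2 = ∑ j, ‖(WithLp.toLp 2 (M.col j) : EuclideanSpace ℝ (Fin p))‖ ^ 2 := by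
  rw [frobNorm, Real.sq_sqrt (by positivity), Finset.sum_comm]
  simp [EuclideanSpace.norm_sq_eq, Matrix.col]

/-- The squared Frobenius norm is a sum over columns, so a bound on vectors passes to matrices
column by column. -/
theorem frobNorm_mul_sq_le {c : ℝ} {M : Matrix (Fin p) (Fin s) ℝ}
    (h : ∀ z : EuclideanSpace ℝ (Fin s),
      ‖toLpLin 2 2 M z‖ ^ 2 ≤ c * ‖z‖ ^ 2) (N : Matrix (Fin s) (Fin q) ℝ) :
    frobNorm (M * N) ^ 2 ≤ c * frobNorm N ^ 2 := by
  rw [frobNorm_sq_eq_sum_col, frobNorm_sq_eq_sum_col, Finset.mul_sum]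
  exact Finset.sum_le_sum fun j _ => h (WithLp.toLp 2 (N.col j))

theorem le_frobNorm_mul_sq {c : ℝ} {M : Matrix (Fin p) (Fin s) ℝ}
    (h : ∀ z : EuclideanSpace ℝ (Fin s),
      c * ‖z‖ ^ 2 ≤ ‖toLpLin 2 2 M z‖ ^ 2) (N : Matrix (Fin s) (Fin q) ℝ) :
    c * frobNorm N ^ 2 ≤ frobNorm (M * N) ^ 2 := by
  rw [frobNorm_sq_eq_sum_col, frobNorm_sq_eq_sum_col, Finset.mul_sum]
  exact Finset.sum_le_sum fun j _ => h (WithLp.toLp 2 (N.col j))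

open scoped Matrix.Norms.L2Operator in
theorem specNorm_nonneg (M : Matrix (Fin p) (Fin q) ℝ) : 0 ≤ specNorm M := norm_nonneg M

open scoped Matrix.Norms.L2Operator in
theorem norm_toLpLin_le (M : Matrix (Fin p) (Fin q) ℝ) (z : EuclideanSpace ℝ (Fin q)) :
    ‖toLpLin 2 2 M z‖ ≤ specNorm M * ‖z‖ := l2_opNorm_mulVec M z

theorem frobNorm_mul_le_specNorm (M : Matrix (Fin p) (Fin s) ℝ) (N : Matrix (Fin s) (Fin q) ℝ) :
    frobNorm (M * N) ≤ specNorm M * frobNorm N := by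
  refine le_of_sq_le_sq ?_ (mul_nonneg (specNorm_nonneg _) (frobNorm_nonneg _))
  rw [mul_pow]
  refine frobNorm_mul_sq_le (fun z => ?_) N
  rw [← mul_pow]
  exact pow_le_pow_left₀ (norm_nonneg _) (norm_toLpLin_le M z) 2

open scoped Matrix.Norms.L2Operator in
theorem specNorm_le_frobNorm (M : Matrix (Fin p) (Fin q) ℝ) : specNorm M ≤ frobNorm M := by
  rw [specNorm, l2_opNorm_def]
  refine ContinuousLinearMap.opNorm_le_bound _ (frobNorm_nonneg _) fun z => ?_
  refine le_of_sq_le_sq ?_ (mul_nonneg (frobNorm_nonneg _) (norm_nonneg _))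
  rw [mul_pow, frobNorm, Real.sq_sqrt (by positivity), EuclideanSpace.norm_sq_eq,
    EuclideanSpace.norm_sq_eq, Finset.sum_mul]
  refine Finset.sum_le_sum fun i _ => ?_
  simpa [mulVec, dotProduct] using Finset.sum_mul_sq_le_sq_mul_sq Finset.univ (M i) z

/-- Both squares are the trace of `(MᵀM)²`, by cyclicity. -/
theorem frobNorm_self_mul_transpose (M : Matrix (Fin p) (Fin q) ℝ) :
    frobNorm (M * Mᵀ) = frobNorm (Mᵀ * M) := by
  have h : frobNorm (M * Mᵀ) ^ 2 = frobNorm (Mᵀ * M) ^ 2 := by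
    rw [← frobInner_self, ← frobInner_self]
    simp only [frobInner, transpose_mul, transpose_transpose]
    rw [Matrix.mul_assoc, trace_mul_comm]
    simp only [Matrix.mul_assoc]
  exact (sq_eq_sq₀ (frobNorm_nonneg _) (frobNorm_nonneg _)).1 h

open scoped Matrix.Norms.L2Operator in
theorem specNorm_sq_le (M : Matrix (Fin p) (Fin q) ℝ) : specNorm M ^ 2 ≤ frobNorm (M * Mᵀ) := by
  have h := l2_opNorm_conjTranspose_mul_self M
  rw [conjTranspose_eq_transpose_of_trivial] at h
  rw [frobNorm_self_mul_transpose, pow_two]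
  unfold specNorm
  rw [← h]
  exact specNorm_le_frobNorm _

/-- `tr(MᵀM) ≤ √q ‖MMᵀ‖_F` for `M` with `q` columns. -/
theorem frobNorm_sq_le_sqrt_mul (M : Matrix (Fin p) (Fin q) ℝ) :
    frobNorm M ^ 2 ≤ Real.sqrt q * frobNorm (M * Mᵀ) := by
  have h1 : frobNorm (1 : Matrix (Fin q) (Fin q) ℝ) = Real.sqrt q := by
    rw [frobNorm]; simp [Matrix.one_apply]
  have h2 : frobNorm M ^ 2 = frobInner 1 (Mᵀ * M) := by
    rw [← frobInner_self]; simp [frobInner]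
  rw [h2, frobNorm_self_mul_transpose, ← h1]
  exact frobInner_le _ _

/-- `‖MMᵀ‖_F ≤ ‖M‖_F²`. -/
theorem frobNorm_mul_transpose_le (M : Matrix (Fin p) (Fin q) ℝ) :
    frobNorm (M * Mᵀ) ≤ frobNorm M ^ 2 := by
  have := frobNorm_mul_le_specNorm M Mᵀ
  rw [frobNorm_transpose] at this
  nlinarith [specNorm_le_frobNorm M, frobNorm_nonneg M]

end Frobenius

/-! ### The measurement operator and the derivatives of the objective -/

section Sensing

variable {m n r k : ℕ} (A : Fin m → Matrix (Fin n) (Fin n) ℝ)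

/-- The measurement operator as a linear map. -/
noncomputable def sensingLin : Matrix (Fin n) (Fin n) ℝ →ₗ[ℝ] EuclideanSpace ℝ (Fin m) where
  toFun := sensing A
  map_add' M N := by ext i; simp [sensing, Matrix.mul_add]
  map_smul' c M := by ext i; simp [sensing]

theorem sensingLin_apply (M : Matrix (Fin n) (Fin n) ℝ) : sensingLin A M = sensing A M := rfl

/-- Moving `𝐀` to the other side gives `⟨𝐀ᵀw, vec M⟩`; Cauchy–Schwarz then isolates the only
quantity through which the noise enters. -/
theorem abs_inner_sensing_le (w : EuclideanSpace ℝ (Fin m)) (M : Matrix (Fin n) (Fin n) ℝ) :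
    |inner ℝ w (sensing A M)| ≤
      ‖(WithLp.toLp 2 ((sensingMatrix A)ᵀ.mulVec w) : EuclideanSpace ℝ (Fin n × Fin n))‖ *
        frobNorm M := by
  have h : inner ℝ w (sensing A M) =
      inner ℝ (WithLp.toLp 2 ((sensingMatrix A)ᵀ.mulVec w) : EuclideanSpace ℝ (Fin n × Fin n))
        (euclVec M) := by
    rw [EuclideanSpace.inner_eq_star_dotProduct, EuclideanSpace.inner_eq_star_dotProduct]
    have h2 : (sensing A M).ofLp = (sensingMatrix A).mulVec M.vec := by
      ext i
      simp only [sensing, ← vec_dotProduct_vec]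
      rfl
    rw [h2, euclVec]
    simp only [star_trivial, mulVec_transpose]
    rw [dotProduct_comm, dotProduct_comm M.vec, dotProduct_mulVec]
  rw [h, frobNorm_eq_norm]
  exact abs_real_inner_le_norm _ _

/-- The polarization `X Uᵀ + U Xᵀ` of the map `X ↦ X Xᵀ`. -/
def symProd (X U : Matrix (Fin n) (Fin r) ℝ) : Matrix (Fin n) (Fin n) ℝ := X * Uᵀ + U * Xᵀ

/-- `X Uᵀ + U Xᵀ` as a bilinear map. -/
noncomputable def symProdLin : Matrix (Fin n) (Fin r) ℝ →ₗ[ℝ] Matrix (Fin n) (Fin r) ℝ →ₗ[ℝ]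
    Matrix (Fin n) (Fin n) ℝ :=
  LinearMap.mk₂ ℝ symProd
    (fun X Y U => by simp only [symProd, Matrix.add_mul, transpose_add, Matrix.mul_add]; abel)
    (fun c X U => by simp [symProd])
    (fun X U V => by simp only [symProd, Matrix.add_mul, transpose_add, Matrix.mul_add]; abel)
    (fun c X U => by simp [symProd])

theorem symProdLin_apply (X U : Matrix (Fin n) (Fin r) ℝ) : symProdLin X U = symProd X U := rfl

theorem symProd_self (X : Matrix (Fin n) (Fin r) ℝ) : symProd X X = (2 : ℝ) • (X * Xᵀ) := by
  rw [symProd, two_smul]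

variable (Mstar : Matrix (Fin n) (Fin n) ℝ) (w : EuclideanSpace ℝ (Fin m))

/-- The residual `𝒜(XXᵀ) - 𝒜(M*) + w`. -/
noncomputable def residual (X : Matrix (Fin n) (Fin r) ℝ) : EuclideanSpace ℝ (Fin m) :=
  sensing A (X * Xᵀ) - sensing A Mstar + w

/-- The residual is quadratic in `X`, so this expansion along a line is exact, and its derivative at
`t = 0` is read off from it. -/
theorem residual_add_smul (X U : Matrix (Fin n) (Fin r) ℝ) (t : ℝ) :
    residual A Mstar w (X + t • U) =
      residual A Mstar w X + t • sensing A (symProd X U) + t ^ 2 • sensing A (U * Uᵀ) := by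
  have h : (X + t • U) * (X + t • U)ᵀ = X * Xᵀ + t • symProd X U + t ^ 2 • (U * Uᵀ) := by
    simp only [symProd, transpose_add, transpose_smul, Matrix.add_mul, Matrix.mul_add, smul_add,
      Matrix.mul_smul, Matrix.smul_mul, smul_smul, pow_two]
    abel
  simp only [residual, h, ← sensingLin_apply, map_add, map_smul]
  abel

theorem hasDerivAt_residual (X U : Matrix (Fin n) (Fin r) ℝ) :
    HasDerivAt (fun t : ℝ => residual A Mstar w (X + t • U)) (sensing A (symProd X U)) 0 := by
  simp only [residual_add_smul]
  have h1 : HasDerivAt (fun t : ℝ => t • sensing A (symProd X U))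
      ((1 : ℝ) • sensing A (symProd X U)) 0 := (hasDerivAt_id (0 : ℝ)).smul_const _
  have h2 : HasDerivAt (fun t : ℝ => t ^ 2 • sensing A (U * Uᵀ))
      ((((2 : ℕ) : ℝ) * (0 : ℝ) ^ (2 - 1)) • sensing A (U * Uᵀ)) 0 :=
    (hasDerivAt_pow 2 (0 : ℝ)).smul_const _
  exact ((h1.const_add (residual A Mstar w X)).add h2).congr_deriv (by simp)

theorem lineDeriv_objective (X U : Matrix (Fin n) (Fin r) ℝ) :
    lineDeriv ℝ (objective A Mstar w) X U =
      inner ℝ (residual A Mstar w X) (sensing A (symProd X U)) := by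
  have h := hasDerivAt_residual A Mstar w X U
  have h2 := (h.norm_sq).const_mul (1 / 2 : ℝ)
  have h3 : HasDerivAt (fun t : ℝ => objective A Mstar w (X + t • U)) _ 0 := h2
  rw [lineDeriv, h3.deriv]
  simp

theorem lineDeriv_inner_residual (X U V : Matrix (Fin n) (Fin r) ℝ) :
    lineDeriv ℝ (fun Y => inner ℝ (residual A Mstar w Y) (sensing A (symProd Y V))) X U =
      inner ℝ (sensing A (symProd X U)) (sensing A (symProd X V)) +
        inner ℝ (residual A Mstar w X) (sensing A (symProd U V)) := by
  have h := hasDerivAt_residual A Mstar w X U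
  have h2 : HasDerivAt (fun t : ℝ => sensing A (symProd (X + t • U) V))
      (sensing A (symProd U V)) 0 := by
    have h3 : (fun t : ℝ => sensing A (symProd (X + t • U) V)) =
        fun t : ℝ => sensing A (symProd X V) + t • sensing A (symProd U V) := by
      ext1 t
      simp only [← sensingLin_apply, ← symProdLin_apply, map_add, map_smul, LinearMap.add_apply,
        LinearMap.smul_apply]
    rw [h3]
    simpa using ((hasDerivAt_id (0 : ℝ)).smul_const (sensing A (symProd U V))).const_add
      (sensing A (symProd X V))
  rw [lineDeriv, (h.inner ℝ h2).deriv]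
  simp [add_comm]

theorem grad_objective_apply (X : Matrix (Fin n) (Fin r) ℝ) (i : Fin n) (j : Fin r) :
    grad (objective A Mstar w) X i j =
      inner ℝ (residual A Mstar w X) (sensing A (symProd X (Matrix.single i j 1))) := by
  simp only [grad, of_apply, partialDeriv, lineDeriv_objective]

theorem hess_objective_apply (X : Matrix (Fin n) (Fin r) ℝ) (a b : Fin r × Fin n) :
    hess (objective A Mstar w) X a b =
      inner ℝ (sensing A (symProd X (Matrix.single a.2 a.1 1)))
          (sensing A (symProd X (Matrix.single b.2 b.1 1))) +
        inner ℝ (residual A Mstar w X)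
          (sensing A (symProd (Matrix.single a.2 a.1 1) (Matrix.single b.2 b.1 1))) := by
  have h : partialDeriv (objective A Mstar w) b.2 b.1 = fun Y => inner ℝ (residual A Mstar w Y)
      (sensing A (symProd Y (Matrix.single b.2 b.1 1))) := by
    ext1 Y
    rw [partialDeriv, lineDeriv_objective]
  simp only [hess, of_apply]
  rw [h, partialDeriv, lineDeriv_inner_residual]

theorem eq_sum_vec_smul_single (U : Matrix (Fin n) (Fin r) ℝ) :
    U = ∑ a : Fin r × Fin n, U.vec a • Matrix.single a.2 a.1 (1 : ℝ) := by
  conv_lhs => rw [matrix_eq_sum_single U]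
  rw [Fintype.sum_prod_type, Finset.sum_comm]
  simp [vec]

theorem frobInner_eq_sum_vec (U V : Matrix (Fin n) (Fin r) ℝ) :
    frobInner U V = ∑ a, U.vec a * V.vec a := by
  rw [frobInner, ← vec_dotProduct_vec]; rfl

theorem frobInner_grad_objective (X U : Matrix (Fin n) (Fin r) ℝ) :
    frobInner U (grad (objective A Mstar w) X) =
      inner ℝ (residual A Mstar w X) (sensing A (symProd X U)) := by
  conv_rhs => rw [eq_sum_vec_smul_single U]
  simp only [← sensingLin_apply, ← symProdLin_apply, map_sum, map_smul, inner_sum,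
    inner_smul_right]
  rw [frobInner_eq_sum_vec]
  refine Finset.sum_congr rfl fun a _ => ?_
  exact congrArg (U.vec a * ·) (grad_objective_apply A Mstar w X a.2 a.1)

/-- Hessian entries are values of a bilinear form at matrix units, so expanding `U` in matrix units
recovers the form at `(U, U)`. The factor 2 comes from `symProd U U = 2UUᵀ`. -/
theorem hess_objective_quadratic (X U : Matrix (Fin n) (Fin r) ℝ) :
    U.vec ⬝ᵥ (hess (objective A Mstar w) X).mulVec U.vec =
      ‖sensing A (symProd X U)‖ ^ 2 +
        2 * inner ℝ (residual A Mstar w X) (sensing A (U * Uᵀ)) := by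
  have h1 : ‖sensing A (symProd X U)‖ ^ 2 +
        2 * inner ℝ (residual A Mstar w X) (sensing A (U * Uᵀ)) =
      inner ℝ (sensing A (symProd X U)) (sensing A (symProd X U)) +
        inner ℝ (residual A Mstar w X) (sensing A (symProd U U)) := by
    rw [symProd_self, real_inner_self_eq_norm_sq]
    simp only [← sensingLin_apply, map_smul, inner_smul_right]
  rw [h1]
  conv_rhs => rw [eq_sum_vec_smul_single U]
  simp only [← sensingLin_apply, ← symProdLin_apply, map_sum, map_smul, inner_sum, sum_inner,
    inner_smul_right, inner_smul_left, LinearMap.sum_apply, LinearMap.smul_apply]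
  simp only [dotProduct, mulVec, hess_objective_apply, Finset.mul_sum]
  rw [← Finset.sum_add_distrib, Finset.sum_comm]
  refine Finset.sum_congr rfl fun a _ => ?_
  rw [← Finset.sum_add_distrib]
  refine Finset.sum_congr rfl fun b _ => ?_
  simp only [← sensingLin_apply, ← symProdLin_apply, conj_trivial]
  ring

variable {A Mstar w}

theorem IsApproxSecondOrder.abs_inner_residual_le {κ : ℝ} {X : Matrix (Fin n) (Fin r) ℝ}
    (h : IsApproxSecondOrder (objective A Mstar w) κ X) (U : Matrix (Fin n) (Fin r) ℝ) :
    |inner ℝ (residual A Mstar w X) (sensing A (symProd X U))| ≤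
      κ * specNorm X * frobNorm U := by
  rw [← frobInner_grad_objective, mul_comm _ (frobNorm U)]
  exact (abs_frobInner_le _ _).trans (mul_le_mul_of_nonneg_left h.1 (frobNorm_nonneg U))

theorem IsApproxSecondOrder.quadratic_nonneg {κ : ℝ} {X : Matrix (Fin n) (Fin r) ℝ}
    (h : IsApproxSecondOrder (objective A Mstar w) κ X) (U : Matrix (Fin n) (Fin r) ℝ) :
    0 ≤ ‖sensing A (symProd X U)‖ ^ 2 +
        2 * inner ℝ (residual A Mstar w X) (sensing A (U * Uᵀ)) + κ * frobNorm U ^ 2 := by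
  have h1 := h.2.dotProduct_mulVec_nonneg U.vec
  rw [star_trivial, add_mulVec, dotProduct_add, hess_objective_quadratic, smul_mulVec,
    one_mulVec, dotProduct_smul, vec_dotProduct_vec] at h1
  rwa [← frobInner_self]

end Sensing

/-! ### The smallest singular value and a rank factorization -/

section Spectral

variable {n r : ℕ}

/-- Diagonalize `XᵀX` in an orthonormal eigenbasis: `σ_r²` is its least eigenvalue. This also covers
`r > n`, where that eigenvalue is zero. -/
theorem sigma_sq_mul_le (X : Matrix (Fin n) (Fin r) ℝ) (hr : 0 < r)
    (z : EuclideanSpace ℝ (Fin r)) : sigma X r ^ 2 * ‖z‖ ^ 2 ≤ ‖toLpLin 2 2 X z‖ ^ 2 := by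
  set T := toLpLin 2 2 X with hT
  have hn : Module.finrank ℝ (EuclideanSpace ℝ (Fin r)) = r := by simp
  have hS := T.isSymmetric_adjoint_comp_self
  set b := hS.eigenvectorBasis hn
  have h1 : ‖T z‖ ^ 2 = ∑ i, hS.eigenvalues hn i * inner ℝ z (b i) ^ 2 := by
    rw [← real_inner_self_eq_norm_sq, ← LinearMap.adjoint_inner_left, ← LinearMap.comp_apply,
      ← b.sum_inner_mul_inner]
    refine Finset.sum_congr rfl fun i _ => ?_
    rw [hS, hS.apply_eigenvectorBasis, inner_smul_right, real_inner_comm z (b i)]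
    simp only [RCLike.ofReal_real_eq_id, id, b]
    ring
  have h2 : ‖z‖ ^ 2 = ∑ i, inner ℝ z (b i) ^ 2 := by
    rw [← b.sum_sq_norm_inner_left]
    simp
  rw [h1, h2, Finset.mul_sum]
  refine Finset.sum_le_sum fun i _ => mul_le_mul_of_nonneg_right ?_ (sq_nonneg _)
  rw [sigma, ← hT, T.sq_singularValues_of_lt hn (Nat.sub_lt hr one_pos)]
  -- Eigenvalues are listed in decreasing order from index 0, so index `r - 1` is the last.
  exact hS.eigenvalues_antitone hn (Fin.le_def.2 (Nat.le_sub_one_of_lt i.2))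

theorem exists_dotProduct_mulVec_eq_sigma_sq (X : Matrix (Fin n) (Fin r) ℝ) (hr : 0 < r) :
    ∃ u : Fin r → ℝ, u ⬝ᵥ u = 1 ∧ X.mulVec u ⬝ᵥ X.mulVec u = sigma X r ^ 2 := by
  set T := toLpLin 2 2 X with hT
  have hn : Module.finrank ℝ (EuclideanSpace ℝ (Fin r)) = r := by simp
  have hS := T.isSymmetric_adjoint_comp_self
  set b := hS.eigenvectorBasis hn
  set i : Fin r := ⟨r - 1, Nat.sub_lt hr one_pos⟩
  have h1 : inner ℝ (b i) (b i) = (1 : ℝ) := by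
    rw [real_inner_self_eq_norm_sq, b.orthonormal.1 i, one_pow]
  refine ⟨(b i).ofLp, ?_, ?_⟩
  · rw [← h1, EuclideanSpace.inner_eq_star_dotProduct, star_trivial]
  · have h2 : X.mulVec (b i).ofLp ⬝ᵥ X.mulVec (b i).ofLp = inner ℝ (T (b i)) (T (b i)) := by
      rw [EuclideanSpace.inner_eq_star_dotProduct, star_trivial]; rfl
    rw [h2, ← LinearMap.adjoint_inner_left, ← LinearMap.comp_apply, hS.apply_eigenvectorBasis,
      inner_smul_left, h1, sigma, ← hT, T.sq_singularValues_of_lt hn (Nat.sub_lt hr one_pos)]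
    simp [i]

/-- The columns of `B` are `√λᵢ uᵢ` over the nonzero eigenvalues only; there are exactly rank-many,
so `B` has no superfluous columns. -/
theorem _root_.Matrix.PosSemidef.exists_eq_mul_transpose {M : Matrix (Fin n) (Fin n) ℝ}
    (hM : M.PosSemidef) (hrank : M.rank = r) :
    ∃ B : Matrix (Fin n) (Fin r) ℝ, M = B * Bᵀ := by
  have hcard : Fintype.card {i // hM.1.eigenvalues i ≠ 0} = Fintype.card (Fin r) := by
    rw [← hM.1.rank_eq_card_non_zero_eigs, hrank, Fintype.card_fin]
  let f := Fintype.equivOfCardEq hcard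
  set U : Matrix (Fin n) (Fin n) ℝ := (hM.1.eigenvectorUnitary : unitaryGroup (Fin n) ℝ).1
  refine ⟨Matrix.of fun i l => U i (f.symm l) * Real.sqrt (hM.1.eigenvalues (f.symm l)), ?_⟩
  ext i j
  have h1 : M i j = ∑ k, U i k * hM.1.eigenvalues k * U j k := by
    conv_lhs => rw [hM.1.spectral_theorem]
    simp [Unitary.conjStarAlgAut_apply, Matrix.mul_apply, diagonal_apply, star_apply, U]
  have h2 : ∀ k, U i k * hM.1.eigenvalues k * U j k =
      (U i k * Real.sqrt (hM.1.eigenvalues k)) * (U j k * Real.sqrt (hM.1.eigenvalues k)) := by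
    intro k
    have := Real.mul_self_sqrt (hM.eigenvalues_nonneg k)
    linear_combination -(U i k * U j k) * this
  rw [h1, Matrix.mul_apply]
  simp only [of_apply, transpose_apply]
  rw [f.symm.sum_comp (fun k : {i // hM.1.eigenvalues i ≠ 0} =>
    U i k * Real.sqrt (hM.1.eigenvalues k) * (U j k * Real.sqrt (hM.1.eigenvalues k)))]
  simp only [← h2]
  refine Eq.trans (Finset.sum_filter_of_ne (p := fun k => hM.1.eigenvalues k ≠ 0) ?_).symm
    (Finset.sum_subtype _ (by simp) fun k => U i k * hM.1.eigenvalues k * U j k)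
  intro k _ h h0
  simp [h0] at h

end Spectral

/-! ### Polarized restricted isometry -/

section RIP

variable {m n r k l g : ℕ} {A : Fin m → Matrix (Fin n) (Fin n) ℝ} {δ : ℝ}

theorem _root_.Matrix.rank_add_le_rank_add_rank (M N : Matrix (Fin n) (Fin k) ℝ) :
    (M + N).rank ≤ M.rank + N.rank := by
  unfold Matrix.rank
  refine (Submodule.finrank_mono (t := LinearMap.range M.mulVecLin ⊔ LinearMap.range N.mulVecLin)
    ?_).trans (Submodule.finrank_add_le_finrank_add_finrank _ _)
  rintro _ ⟨z, rfl⟩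
  rw [mulVecLin_add, LinearMap.add_apply]
  exact Submodule.add_mem_sup ⟨z, rfl⟩ ⟨z, rfl⟩

theorem rank_mul_add_mul_le (X : Matrix (Fin n) (Fin k) ℝ) (C : Matrix (Fin k) (Fin n) ℝ)
    (Y : Matrix (Fin n) (Fin l) ℝ) (D : Matrix (Fin l) (Fin n) ℝ) :
    (X * C + Y * D).rank ≤ k + l := by
  refine (rank_add_le_rank_add_rank _ _).trans (Nat.add_le_add ?_ ?_)
  · exact (rank_mul_le_left X C).trans (rank_le_width X)
  · exact (rank_mul_le_left Y D).trans (rank_le_width Y)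

/-- Polarization: the lower RIP bound on a sum minus the upper one on a difference, for combinations
of `M` and `N`. This is why every combination must have bounded rank. -/
theorem HasRIP.le_inner (h : HasRIP A δ g) {M N : Matrix (Fin n) (Fin n) ℝ}
    (hrank : ∀ a b : ℝ, (a • M + b • N).rank ≤ g) :
    frobInner M N - δ * (frobNorm M * frobNorm N) ≤ inner ℝ (sensing A M) (sensing A N) := by
  rcases (frobNorm_nonneg M).eq_or_lt with hM | hM
  · rw [eq_zero_of_frobNorm_eq_zero hM.symm]
    simp [frobInner, ← sensingLin_apply, frobNorm]
  rcases (frobNorm_nonneg N).eq_or_lt with hN | hN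
  · rw [eq_zero_of_frobNorm_eq_zero hN.symm]
    simp [frobInner, ← sensingLin_apply, frobNorm]
  -- Scaling each matrix by the other's norm equalizes the two norms, so the error is exactly
  -- `δ‖M‖_F‖N‖_F`.
  set a := frobNorm M
  set b := frobNorm N
  have h1 := (h.2.2 (b • M + a • N) (hrank b a)).1
  have h2 := (h.2.2 (b • M + (-a) • N) (hrank b (-a))).2
  simp only [← frobInner_self, ← real_inner_self_eq_norm_sq, ← sensingLin_apply, map_add,
    map_smul, inner_add_left, inner_add_right, frobInner_add_left, frobInner_add_right,
    frobInner_smul_left, frobInner_smul_right, inner_smul_left, inner_smul_right, conj_trivial]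
    at h1 h2
  simp only [sensingLin_apply] at h1 h2
  rw [frobInner_comm N M, real_inner_comm (sensing A M) (sensing A N), frobInner_self,
    frobInner_self] at h1 h2
  have h3 : 0 ≤ 4 * (a * b) * (inner ℝ (sensing A M) (sensing A N) -
    (frobInner M N - δ * (a * b))) := by
    simp only [a, b] at *
    linarith
  have := nonneg_of_mul_nonneg_right h3 (by positivity)
  linarith

end RIP

/-! ### Curvature along rank-one directions -/

section SecondOrder

variable {m n r k g : ℕ} {A : Fin m → Matrix (Fin n) (Fin n) ℝ} {δ κ : ℝ}
  {Mstar : Matrix (Fin n) (Fin n) ℝ} {w : EuclideanSpace ℝ (Fin m)} {X : Matrix (Fin n) (Fin r) ℝ}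

theorem frobInner_vecMulVec {p q : ℕ} (a c : Fin p → ℝ) (b d : Fin q → ℝ) :
    frobInner (vecMulVec a b) (vecMulVec c d) = (a ⬝ᵥ c) * (b ⬝ᵥ d) := by
  rw [frobInner, transpose_vecMulVec, vecMulVec_mul_vecMulVec, trace_vecMulVec, dotProduct_smul, smul_eq_mul]

theorem mul_transpose_eq_sum_vecMulVec (V : Matrix (Fin n) (Fin k) ℝ) :
    V * Vᵀ = ∑ j, vecMulVec (V.col j) (V.col j) := by
  ext a b
  simp [Matrix.mul_apply, Matrix.sum_apply, vecMulVec_apply, col]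

theorem frobNorm_sq_eq_sum_dotProduct (V : Matrix (Fin n) (Fin k) ℝ) :
    frobNorm V ^ 2 = ∑ j, V.col j ⬝ᵥ V.col j := by
  rw [← frobInner_self, frobInner]; rfl

/-- For `U = a uᵀ` with `u` a unit vector, `UUᵀ = aaᵀ` no longer involves `u`, while `XUᵀ + UXᵀ` has
rank at most 2, so the upper RIP bound applies. Choosing `u` so that `Xu` is short makes the
positive term small. -/
theorem IsApproxSecondOrder.rank_one_nonneg
    (h : IsApproxSecondOrder (objective A Mstar w) κ X) (hRIP : HasRIP A δ g) (hg : 2 ≤ g)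
    {u : Fin r → ℝ} (hu : u ⬝ᵥ u = 1) (a : Fin n → ℝ) :
    0 ≤ (1 + δ) * (2 * (X.mulVec u ⬝ᵥ X.mulVec u) * (a ⬝ᵥ a) + 2 * (X.mulVec u ⬝ᵥ a) ^ 2) +
      2 * inner ℝ (residual A Mstar w X) (sensing A (vecMulVec a a)) + κ * (a ⬝ᵥ a) := by
  have h1 := h.quadratic_nonneg (vecMulVec a u)
  have h2 : symProd X (vecMulVec a u) =
      vecMulVec (X.mulVec u) a + vecMulVec a (X.mulVec u) := by
    rw [symProd, transpose_vecMulVec, mul_vecMulVec, vecMulVec_mul, vecMul_transpose]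
  have h3 : vecMulVec a u * (vecMulVec a u)ᵀ = vecMulVec a a := by
    rw [transpose_vecMulVec, vecMulVec_mul_vecMulVec, hu, one_smul]
  have h4 : (symProd X (vecMulVec a u)).rank ≤ g := by
    rw [h2]
    refine (rank_add_le_rank_add_rank _ _).trans (le_trans ?_ hg)
    exact Nat.add_le_add (rank_vecMulVec_le _ _) (rank_vecMulVec_le _ _)
  have h5 := (hRIP.2.2 _ h4).2
  have h6 : frobNorm (symProd X (vecMulVec a u)) ^ 2 =
      2 * (X.mulVec u ⬝ᵥ X.mulVec u) * (a ⬝ᵥ a) + 2 * (X.mulVec u ⬝ᵥ a) ^ 2 := by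
    rw [h2, ← frobInner_self]
    simp only [frobInner_add_left, frobInner_add_right, frobInner_vecMulVec]
    rw [dotProduct_comm a (X.mulVec u)]
    ring
  rw [h3, ← frobInner_self (vecMulVec a u), frobInner_vecMulVec, hu, mul_one] at h1
  rw [h6] at h5
  linarith

theorem IsApproxSecondOrder.psd_direction_nonneg
    (h : IsApproxSecondOrder (objective A Mstar w) κ X) (hRIP : HasRIP A δ g) (hg : 2 ≤ g)
    {u : Fin r → ℝ} (hu : u ⬝ᵥ u = 1) (V : Matrix (Fin n) (Fin k) ℝ) :
    0 ≤ (1 + δ) * (2 * (X.mulVec u ⬝ᵥ X.mulVec u) * frobNorm V ^ 2 +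
        2 * ∑ j, (X.mulVec u ⬝ᵥ V.col j) ^ 2) +
      2 * inner ℝ (residual A Mstar w X) (sensing A (V * Vᵀ)) + κ * frobNorm V ^ 2 := by
  have h1 := Finset.sum_nonneg fun j (_ : j ∈ Finset.univ) =>
    h.rank_one_nonneg hRIP hg hu (V.col j)
  rw [frobNorm_sq_eq_sum_dotProduct, mul_transpose_eq_sum_vecMulVec, ← sensingLin_apply, map_sum,
    inner_sum]
  simp only [Finset.sum_add_distrib, ← Finset.mul_sum] at h1
  exact h1

end SecondOrder

/-! ### Splitting the error along the range of `X` -/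

section Tangent

variable {n r k q : ℕ} {σ : ℝ}

theorem frobNorm_add_sq {p q : ℕ} (M N : Matrix (Fin p) (Fin q) ℝ) :
    frobNorm (M + N) ^ 2 = frobNorm M ^ 2 + 2 * frobInner M N + frobNorm N ^ 2 := by
  simp only [← frobInner_self, frobInner_add_left, frobInner_add_right]
  rw [frobInner_comm N M]
  ring

theorem frobNorm_smul_sq {p q : ℕ} (c : ℝ) (M : Matrix (Fin p) (Fin q) ℝ) :
    frobNorm (c • M) ^ 2 = c ^ 2 * frobNorm M ^ 2 := by
  rw [frobNorm_smul, mul_pow, sq_abs]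

theorem frobNorm_one_sq : frobNorm (1 : Matrix (Fin q) (Fin q) ℝ) ^ 2 = q := by
  rw [← frobInner_self]; simp [frobInner]

theorem sq_mul_frobNorm_sq_le {X : Matrix (Fin n) (Fin r) ℝ} (hr : 0 < r)
    (C : Matrix (Fin r) (Fin q) ℝ) :
    sigma X r ^ 2 * frobNorm C ^ 2 ≤ frobNorm (X * C) ^ 2 :=
  le_frobNorm_mul_sq (sigma_sq_mul_le X hr) C

/-- A matrix with positive smallest singular value has a left inverse `X⁺` such that `X X⁺` is
symmetric. -/
theorem exists_left_inverse {X : Matrix (Fin n) (Fin r) ℝ} (hr : 0 < r) (hσ : 0 < sigma X r) :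
    ∃ Y : Matrix (Fin r) (Fin n) ℝ, Y * X = 1 ∧ (X * Y)ᵀ = X * Y := by
  have hinj : Function.Injective X.mulVec := by
    intro y z hyz
    have h := sigma_sq_mul_le X hr (WithLp.toLp 2 (y - z))
    have h0 : toLpLin 2 2 X (WithLp.toLp 2 (y - z)) = 0 := by
      rw [toLpLin_toLp, toLin'_apply, mulVec_sub]
      have : X.mulVec y = X.mulVec z := hyz
      simp [this]
    rw [h0, norm_zero, zero_pow two_ne_zero] at h
    have h1 : ‖(WithLp.toLp 2 (y - z) : EuclideanSpace ℝ (Fin r))‖ ^ 2 ≤ 0 :=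
      nonpos_of_mul_nonpos_right h (by positivity)
    have h2 := norm_eq_zero.1 (pow_eq_zero_iff two_ne_zero |>.1 (le_antisymm h1 (sq_nonneg _)))
    exact sub_eq_zero.1 (congrArg WithLp.ofLp h2)
  have hpd : (Xᵀ * X).PosDef := by
    rw [← conjTranspose_eq_transpose_of_trivial]
    exact PosDef.conjTranspose_mul_self X hinj
  have hu : IsUnit (Xᵀ * X).det := (isUnit_iff_isUnit_det _).1 hpd.isUnit
  refine ⟨(Xᵀ * X)⁻¹ * Xᵀ, ?_, ?_⟩
  · rw [Matrix.mul_assoc, nonsing_inv_mul _ hu]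
  · simp only [transpose_mul, transpose_nonsing_inv, transpose_transpose, Matrix.mul_assoc]

theorem frobInner_sandwich (M K N L : Matrix (Fin n) (Fin n) ℝ) :
    frobInner (M * K * N) L = frobInner K (Mᵀ * L * Nᵀ) := by
  rw [frobInner_mul_left', frobInner_mul_left, Matrix.mul_assoc]

/-- Orthogonality of the blocks of a matrix with respect to complementary projections. -/
theorem frobInner_compl_eq_zero {P Q E F : Matrix (Fin n) (Fin n) ℝ} (hPQ : Pᵀ * Q = 0)
    (M N : Matrix (Fin n) (Fin n) ℝ) : frobInner (P * E * M) (Q * F * N) = 0 := by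
  rw [frobInner_sandwich, ← Matrix.mul_assoc, ← Matrix.mul_assoc, hPQ]
  simp [frobInner]

theorem frobInner_compl_eq_zero' {P Q E F : Matrix (Fin n) (Fin n) ℝ} (hPQ : Q * Pᵀ = 0)
    (M N : Matrix (Fin n) (Fin n) ℝ) : frobInner (M * E * P) (N * F * Q) = 0 := by
  rw [frobInner_sandwich, Matrix.mul_assoc, Matrix.mul_assoc _ Q, hPQ]
  simp [frobInner]

/-- The lower bound on the distance to a scaled identity when the residual block is accounted
for. -/
theorem le_frobNorm_smul_one_sub_sq_add (A : Matrix (Fin r) (Fin k) ℝ)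
    (V : Matrix (Fin n) (Fin k) ℝ) {c : ℝ} (hc : c ≤ 1) (s : ℝ) :
    ((r : ℝ) - k) * s ^ 2 + 2 * c * s * frobNorm V ^ 2 - c ^ 2 * frobNorm (V * Vᵀ) ^ 2 ≤
      frobNorm (s • (1 : Matrix (Fin r) (Fin r) ℝ) - A * Aᵀ) ^ 2 +
        2 * frobNorm (A * Vᵀ) ^ 2 := by
  -- Expanding this square gives the claim: passing from `AAᵀ` to `AᵀA` trades `r` for `k` in the
  -- `s²` term, and `c ≤ 1` lets `2‖AVᵀ‖²` absorb the cross term `2c‖AVᵀ‖²`.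
  have h0 := sq_nonneg (frobNorm (Aᵀ * A + c • (Vᵀ * V) + (-s) • (1 : Matrix (Fin k) (Fin k) ℝ)))
  have h1 : frobNorm (A * Vᵀ) ^ 2 = frobInner (Aᵀ * A) (Vᵀ * V) := by
    rw [← frobInner_self, frobInner_mul_left, frobInner_comm, ← Matrix.mul_assoc,
      frobInner_mul_left', transpose_transpose]
  have hone : ∀ {p l : ℕ} (M : Matrix (Fin p) (Fin l) ℝ),
      frobInner (Mᵀ * M) 1 = frobNorm M ^ 2 := by
    intro p l M
    rw [← frobInner_self, frobInner_mul_left, transpose_transpose, Matrix.mul_one]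
  have h2 := sq_nonneg (frobNorm (A * Vᵀ))
  have h3 : frobNorm (s • (1 : Matrix (Fin r) (Fin r) ℝ) - A * Aᵀ) ^ 2 =
      r * s ^ 2 - 2 * s * frobNorm A ^ 2 + frobNorm (Aᵀ * A) ^ 2 := by
    have h4 := hone Aᵀ
    rw [transpose_transpose, frobNorm_transpose] at h4
    rw [← frobInner_self]
    simp only [frobInner_sub_left, frobInner_sub_right, frobInner_smul_left,
      frobInner_smul_right]
    rw [frobInner_comm 1 (A * Aᵀ), h4, frobInner_self, frobInner_self, frobNorm_one_sq,
      frobNorm_self_mul_transpose]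
    ring
  simp only [frobNorm_add_sq, frobInner_add_left, frobInner_smul_left, frobInner_smul_right,
    frobNorm_smul_sq, frobNorm_one_sq, hone, ← h1] at h0
  rw [h3, frobNorm_self_mul_transpose V]
  nlinarith

variable {X : Matrix (Fin n) (Fin r) ℝ} {Y : Matrix (Fin r) (Fin n) ℝ}

theorem proj_mul_compl (hYX : Y * X = 1) : X * Y * (1 - X * Y) = 0 := by
  rw [Matrix.mul_sub, Matrix.mul_one, Matrix.mul_assoc X Y, ← Matrix.mul_assoc Y X, hYX,
    Matrix.one_mul, sub_self]

theorem compl_mul_proj (hYX : Y * X = 1) : (1 - X * Y) * (X * Y) = 0 := by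
  rw [Matrix.sub_mul, Matrix.one_mul, Matrix.mul_assoc X Y, ← Matrix.mul_assoc Y X, hYX,
    Matrix.one_mul, sub_self]

theorem compl_mul_self (hYX : Y * X = 1) : (1 - X * Y) * X = 0 := by
  rw [Matrix.sub_mul, Matrix.one_mul, Matrix.mul_assoc, hYX, Matrix.mul_one, sub_self]

theorem compl_transpose (hP : (X * Y)ᵀ = X * Y) : (1 - X * Y)ᵀ = 1 - X * Y := by
  rw [transpose_sub, transpose_one, hP]

theorem transpose_mul_compl (hYX : Y * X = 1) (hP : (X * Y)ᵀ = X * Y) : Xᵀ * (1 - X * Y) = 0 := by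
  rw [← compl_transpose hP, ← transpose_mul, compl_mul_self hYX, transpose_zero]

theorem compl_mul_compl (hYX : Y * X = 1) : (1 - X * Y) * (1 - X * Y) = 1 - X * Y := by
  rw [Matrix.sub_mul, Matrix.one_mul, proj_mul_compl hYX, sub_zero]

/-- The norm of a symmetric matrix with its complementary diagonal block removed. -/
theorem frobNorm_sub_compl_block_sq (hYX : Y * X = 1) (hP : (X * Y)ᵀ = X * Y)
    {E : Matrix (Fin n) (Fin n) ℝ} (hE : Eᵀ = E) :
    frobNorm (E - (1 - X * Y) * E * (1 - X * Y)) ^ 2 =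
      frobNorm (X * Y * E * (X * Y)) ^ 2 + 2 * frobNorm (X * Y * E * (1 - X * Y)) ^ 2 := by
  have hPQ := proj_mul_compl hYX
  have hQP := compl_mul_proj hYX
  have hQ := compl_transpose hP
  set P := X * Y with hPdef
  set Q := 1 - P with hQdef
  have h1 : E - Q * E * Q = P * E * P + P * E * Q + Q * E * P := by
    have : P = 1 - Q := by rw [hQdef]; abel
    rw [this]
    noncomm_ring
  have h2 : frobNorm (Q * E * P) = frobNorm (P * E * Q) := by
    rw [← frobNorm_transpose, transpose_mul (Q * E), transpose_mul Q, hP, hQ, hE, Matrix.mul_assoc P]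
  rw [h1, frobNorm_add_sq, frobNorm_add_sq, frobInner_add_left,
    frobInner_compl_eq_zero' (by rw [hP, hQP]), frobInner_compl_eq_zero (by rw [hP, hPQ]),
    frobInner_compl_eq_zero (by rw [hP, hPQ]), h2]
  ring

/-- Every symmetric matrix minus its complementary diagonal block is of the form `XUᵀ + UXᵀ`,
with control on `U`. -/
theorem exists_symProd_eq (hr : 0 < r) (hYX : Y * X = 1) (hP : (X * Y)ᵀ = X * Y)
    {E : Matrix (Fin n) (Fin n) ℝ} (hE : Eᵀ = E) :
    ∃ U : Matrix (Fin n) (Fin r) ℝ, symProd X U = E - (1 - X * Y) * E * (1 - X * Y) ∧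
      2 * sigma X r ^ 2 * frobNorm U ^ 2 ≤
        frobNorm (E - (1 - X * Y) * E * (1 - X * Y)) ^ 2 := by
  have hPQ := proj_mul_compl hYX
  have hQP := compl_mul_proj hYX
  have hQ := compl_transpose hP
  -- The factor 1/2 on the diagonal block compensates for its being counted twice once the transpose
  -- is added.
  have hX : X * (Y * E * (1 - (1 / 2 : ℝ) • (X * Y))) =
      (1 / 2 : ℝ) • (X * Y * E * (X * Y)) + X * Y * E * (1 - X * Y) := by
    simp only [Matrix.mul_sub, Matrix.mul_one, Matrix.mul_smul, ← Matrix.mul_assoc]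
    module
  refine ⟨(Y * E * (1 - (1 / 2 : ℝ) • (X * Y)))ᵀ, ?_, ?_⟩
  · have h2 : ∀ Z : Matrix (Fin r) (Fin n) ℝ, symProd X Zᵀ = X * Z + (X * Z)ᵀ := by
      intro Z; rw [symProd, transpose_transpose, transpose_mul]
    rw [h2, hX]
    simp only [transpose_add, transpose_smul, transpose_mul (X * Y * E), transpose_mul (X * Y) E,
      hP, hQ, hE]
    simp only [Matrix.mul_sub, Matrix.sub_mul, Matrix.mul_one, Matrix.one_mul, ← Matrix.mul_assoc]
    module
  · rw [frobNorm_transpose, frobNorm_sub_compl_block_sq hYX hP hE]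
    have h3 := sq_mul_frobNorm_sq_le (X := X) hr (Y * E * (1 - (1 / 2 : ℝ) • (X * Y)))
    rw [hX, frobNorm_add_sq, frobNorm_smul_sq, frobInner_smul_left,
      frobInner_compl_eq_zero' (by rw [hP, hQP])] at h3
    nlinarith [sq_nonneg (frobNorm (X * Y * E * (X * Y)))]

variable {B : Matrix (Fin n) (Fin k) ℝ}

/-- The complementary projection annihilates `X`, so only the part of `B` outside the range of `X`
survives. -/
theorem compl_block_residual (hYX : Y * X = 1) (hP : (X * Y)ᵀ = X * Y) :
    (1 - X * Y) * (X * Xᵀ - B * Bᵀ) * (1 - X * Y) =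
      -(((1 - X * Y) * B) * ((1 - X * Y) * B)ᵀ) := by
  rw [transpose_mul, compl_transpose hP, Matrix.mul_sub (1 - X * Y) (X * Xᵀ),
    ← Matrix.mul_assoc, compl_mul_self hYX,
    Matrix.zero_mul, zero_sub, Matrix.neg_mul]
  simp only [Matrix.mul_assoc]

/-- In the coordinates given by the left inverse `Y`, the diagonal block of `E` is `1 - (YB)(YB)ᵀ`
and the off-diagonal one is `-(YB)Vᵀ`. Returning through `X` multiplies norms by at least `σ` on
each side concerned, which reduces the claim to the estimate for a scaled identity with `A = σYB`
and scalar `σ²`. -/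
theorem le_frobNorm_tangent_sq (hr : 0 < r) (hYX : Y * X = 1) (hP : (X * Y)ᵀ = X * Y)
    {c : ℝ} (hc : c ≤ 1) {V : Matrix (Fin n) (Fin k) ℝ} (hV : V = (1 - X * Y) * B) :
    ((r : ℝ) - k) * sigma X r ^ 4 + 2 * c * sigma X r ^ 2 * frobNorm V ^ 2 -
        c ^ 2 * frobNorm (V * Vᵀ) ^ 2 ≤
      frobNorm (X * Xᵀ - B * Bᵀ + V * Vᵀ) ^ 2 := by
  set E := X * Xᵀ - B * Bᵀ with hEdef
  set s := sigma X r
  have hE : Eᵀ = E := by simp [hEdef]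
  have hT : E + V * Vᵀ = E - (1 - X * Y) * E * (1 - X * Y) := by
    rw [hEdef, compl_block_residual hYX hP, hV, sub_neg_eq_add]
  have hYt : Xᵀ * Yᵀ = 1 := by rw [← transpose_mul, hYX, transpose_one]
  rw [hT, frobNorm_sub_compl_block_sq hYX hP hE]
  have h0 := le_frobNorm_smul_one_sub_sq_add (s • (Y * B)) V hc (s ^ 2)
  have h1 : s ^ 2 • (1 : Matrix (Fin r) (Fin r) ℝ) - (s • (Y * B)) * (s • (Y * B))ᵀ =
      s ^ 2 • (Y * (E * Yᵀ)) := by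
    have : Y * (E * Yᵀ) = 1 - (Y * B) * (Y * B)ᵀ := by
      rw [hEdef, Matrix.sub_mul, Matrix.mul_sub, Matrix.mul_assoc X, hYt, Matrix.mul_one, hYX,
        transpose_mul]
      simp only [Matrix.mul_assoc]
    rw [this, smul_sub, transpose_smul, Matrix.smul_mul, Matrix.mul_smul, smul_smul, pow_two]
  have h2 : (s • (Y * B)) * Vᵀ = (-s) • (Y * (E * (1 - X * Y))) := by
    rw [hEdef, Matrix.sub_mul, Matrix.mul_assoc X, transpose_mul_compl hYX hP, Matrix.mul_zero,
      zero_sub, hV, transpose_mul, compl_transpose hP]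
    simp [Matrix.mul_assoc]
  have h3 : s ^ 2 * frobNorm (Y * (E * (1 - X * Y))) ^ 2 ≤
      frobNorm (X * Y * E * (1 - X * Y)) ^ 2 := by
    have := sq_mul_frobNorm_sq_le (X := X) hr (Y * (E * (1 - X * Y)))
    simpa only [← Matrix.mul_assoc] using this
  have h4 : s ^ 2 * frobNorm (Y * (E * (X * Y))) ^ 2 ≤ frobNorm (X * Y * E * (X * Y)) ^ 2 := by
    have := sq_mul_frobNorm_sq_le (X := X) hr (Y * (E * (X * Y)))
    simpa only [← Matrix.mul_assoc] using this
  have h5 : s ^ 2 * frobNorm (Y * (E * Yᵀ)) ^ 2 ≤ frobNorm (Y * (E * (X * Y))) ^ 2 := by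
    have := sq_mul_frobNorm_sq_le (X := X) hr (Y * (E * Yᵀ))
    rw [← frobNorm_transpose (Y * (E * (X * Y))), transpose_mul, transpose_mul, hP, hE]
    simpa only [← Matrix.mul_assoc] using this
  rw [h1, h2, frobNorm_smul_sq, frobNorm_smul_sq, neg_sq] at h0
  have h6 := mul_le_mul_of_nonneg_left h5 (sq_nonneg s)
  nlinarith

theorem frobInner_tangent_compl_eq_zero (hYX : Y * X = 1) (hP : (X * Y)ᵀ = X * Y)
    {V : Matrix (Fin n) (Fin k) ℝ} (hV : V = (1 - X * Y) * B) :
    frobInner (X * Xᵀ - B * Bᵀ + V * Vᵀ) (V * Vᵀ) = 0 := by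
  have hQ := compl_transpose hP
  have hW : V * Vᵀ = (1 - X * Y) * (V * Vᵀ) * (1 - X * Y) := by
    have h1 : (1 - X * Y) * V = V := by
      rw [hV, ← Matrix.mul_assoc, compl_mul_compl hYX]
    have h2 : Vᵀ * (1 - X * Y) = Vᵀ := by
      conv_rhs => rw [← h1, transpose_mul, hQ]
    rw [← Matrix.mul_assoc, h1, Matrix.mul_assoc, h2]
  have h3 : frobInner (X * Xᵀ - B * Bᵀ) (V * Vᵀ) = -frobInner (V * Vᵀ) (V * Vᵀ) := by
    conv_lhs => rw [hW]
    have := frobInner_sandwich (1 - X * Y) (X * Xᵀ - B * Bᵀ) (1 - X * Y) (V * Vᵀ)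
    rw [hQ, compl_block_residual hYX hP, ← hV] at this
    rw [← this]
    simp [frobInner]
  rw [frobInner_add_left, h3, neg_add_cancel]

end Tangent

/-! ### Choice of the test direction -/

section Scalar

/-- The scalar inequality behind the choice of the certificate direction. -/
theorem exists_certificate_coeff {p q τ s ρ R Rs : ℝ} (hq : 0 ≤ q) (hτ : 0 ≤ τ)
    (hs : 0 ≤ s) (hρ : 0 < ρ) (hρ1 : ρ ≤ 1) (hRs : ρ ^ 2 * R = Rs) (hRs0 : 0 ≤ Rs)
    (hτq : τ ≤ Real.sqrt Rs * q)
    (hp : ∀ c ≤ 1, (R - Rs) * s ^ 2 + 2 * c * s * τ - c ^ 2 * q ^ 2 ≤ p ^ 2) :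
    ∃ b : ℝ, 0 ≤ b ∧ p ^ 2 + q ^ 2 ≤ (1 + ρ) ^ 2 * p ^ 2 + b ^ 2 * q ^ 2 ∧
      (1 + ρ) * b * q ^ 2 - (2 + ρ) * b * s * τ = b ^ 2 * q ^ 2 := by
  rcases hq.eq_or_lt with rfl | hq
  · refine ⟨0, le_rfl, ?_, by ring⟩
    nlinarith [mul_nonneg hρ.le (sq_nonneg p), mul_nonneg (sq_nonneg ρ) (sq_nonneg p)]
  obtain ⟨β, hβ⟩ : ∃ β, β = s * τ / q := ⟨_, rfl⟩
  have hβq : s * τ = β * q := by rw [hβ]; field_simp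
  have hβ0 : 0 ≤ β := by rw [hβ]; positivity
  have hβs : β ^ 2 ≤ s ^ 2 * Rs := by
    have h1 : β ≤ s * Real.sqrt Rs := by
      rw [hβ, div_le_iff₀ hq]
      nlinarith
    calc β ^ 2 ≤ (s * Real.sqrt Rs) ^ 2 := pow_le_pow_left₀ hβ0 h1 2
      _ = s ^ 2 * Rs := by rw [mul_pow, Real.sq_sqrt hRs0]
  -- Take `c = m/q` in `hp`. Both `s²Rs ≥ m²` and `2mβ - m² ≥ m²` hold, and `(R - Rs)s² = (ρ⁻² -
  -- 1)s²Rs`, so the left side is at least `m²/ρ²`.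
  have key : ∀ m, 0 ≤ m → m ≤ β → m ≤ q → m ^ 2 ≤ ρ ^ 2 * p ^ 2 := by
    intro m hm hmβ hmq
    have h1 := hp (m / q) ((div_le_one hq).2 hmq)
    have h2 : 2 * (m / q) * s * τ = 2 * m * β := by
      have : 2 * (m / q) * s * τ = 2 * (m / q) * (s * τ) := by ring
      rw [this, hβq]; field_simp
    have h3 : (m / q) ^ 2 * q ^ 2 = m ^ 2 := by field_simp
    rw [h2, h3] at h1
    have h4 : m ^ 2 ≤ s ^ 2 * Rs := (pow_le_pow_left₀ hm hmβ 2).trans hβs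
    have h5 : ρ ^ 2 * ((R - Rs) * s ^ 2) = (1 - ρ ^ 2) * (s ^ 2 * Rs) := by rw [← hRs]; ring
    have h6 : (1 - ρ ^ 2) * m ^ 2 ≤ (1 - ρ ^ 2) * (s ^ 2 * Rs) :=
      mul_le_mul_of_nonneg_left h4 (by nlinarith)
    have h7 : m ^ 2 ≤ 2 * m * β - m ^ 2 := by nlinarith
    have h8 := mul_le_mul_of_nonneg_left h1 (sq_nonneg ρ)
    have h9 := mul_le_mul_of_nonneg_left h7 (sq_nonneg ρ)
    nlinarith
  rcases le_total ((2 + ρ) * β) ((1 + ρ) * q) with h | h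
  · have hβle : β ≤ q := by nlinarith
    -- For `q > 0`, this is the nonzero solution `b` of the required equation after substituting `sτ
    -- = βq`; the case hypothesis says that it is nonnegative.
    refine ⟨((1 + ρ) * q - (2 + ρ) * β) / q, div_nonneg (by linarith) hq.le, ?_, ?_⟩
    · have h1 := key β hβ0 le_rfl hβle
      have h2 : (((1 + ρ) * q - (2 + ρ) * β) / q) ^ 2 * q ^ 2 =
        ((1 + ρ) * q - (2 + ρ) * β) ^ 2 := by field_simp
      rw [h2]
      -- After `β² ≤ ρ²p²` is used, the remainder is the perfect square `(2 + ρ)(ρq - (1 + ρ)β)²`.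
      have h3 : 0 ≤ ρ * ((1 + ρ) ^ 2 * p ^ 2 + ((1 + ρ) * q - (2 + ρ) * β) ^ 2 -
          (p ^ 2 + q ^ 2)) := by
        have h4 := mul_le_mul_of_nonneg_left h1 (by linarith : (0 : ℝ) ≤ 2 + ρ)
        have h5 := mul_nonneg (by linarith : (0 : ℝ) ≤ 2 + ρ) (sq_nonneg (ρ * q - (1 + ρ) * β))
        linarith
      linarith [nonneg_of_mul_nonneg_right h3 hρ]
    · have h1 : ∀ b : ℝ, (2 + ρ) * b * s * τ = (2 + ρ) * b * (β * q) := by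
        intro b; rw [← hβq]; ring
      rw [h1]
      field_simp
  -- That solution would now be nonpositive. Since `β` is comparable to `q` or larger, `F` alone
  -- dominates and `W` can be dropped.
  · refine ⟨0, le_rfl, ?_, by ring⟩
    have h3 : 0 ≤ ρ * ((1 + ρ) ^ 2 * p ^ 2 - (p ^ 2 + q ^ 2)) := by
      have h0 : ρ * q ^ 2 ≤ (2 + ρ) * (ρ ^ 2 * p ^ 2) := by
        rcases le_total β q with hb | hb
        · have h1 := mul_le_mul_of_nonneg_left (key β hβ0 le_rfl hb)
            (by linarith : (0 : ℝ) ≤ 2 + ρ)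
          have h2 : ((1 + ρ) * q) ^ 2 ≤ ((2 + ρ) * β) ^ 2 :=
            pow_le_pow_left₀ (by positivity) h 2
          have h4 : (2 + ρ) * (ρ * q ^ 2) ≤ (2 + ρ) * ((2 + ρ) * β ^ 2) := by
            nlinarith [sq_nonneg q]
          exact (le_of_mul_le_mul_left h4 (by linarith)).trans h1
        · have h1 := mul_le_mul_of_nonneg_left (key q hq.le hb le_rfl)
            (by linarith : (0 : ℝ) ≤ 2 + ρ)
          nlinarith [sq_nonneg q]
      linarith
    linarith [nonneg_of_mul_nonneg_right h3 hρ]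

end Scalar

/-! ### The two error bounds -/

section Recovery

variable {m n r rstar : ℕ} {A : Fin m → Matrix (Fin n) (Fin n) ℝ} {δ ε κ : ℝ}
  {Mstar : Matrix (Fin n) (Fin n) ℝ} {w : EuclideanSpace ℝ (Fin m)} {X : Matrix (Fin n) (Fin r) ℝ}

theorem residual_eq (X : Matrix (Fin n) (Fin r) ℝ) :
    residual A Mstar w X = sensing A (X * Xᵀ - Mstar) + w := by
  rw [residual, ← sensingLin_apply A (X * Xᵀ - Mstar), map_sub]
  rfl

/-- The noise perturbs the residual pairing by at most `ε ‖M‖_F`. -/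
theorem abs_inner_residual_sub_le
    (hw : ‖(WithLp.toLp 2 ((sensingMatrix A)ᵀ.mulVec w) : EuclideanSpace ℝ (Fin n × Fin n))‖ ≤ ε)
    (M : Matrix (Fin n) (Fin n) ℝ) :
    |inner ℝ (residual A Mstar w X) (sensing A M) -
      inner ℝ (sensing A (X * Xᵀ - Mstar)) (sensing A M)| ≤ ε * frobNorm M := by
  rw [residual_eq, inner_add_left, add_sub_cancel_left]
  exact (abs_inner_sensing_le A w M).trans (mul_le_mul_of_nonneg_right hw (frobNorm_nonneg M))

theorem frobNorm_symProd_le (X U : Matrix (Fin n) (Fin r) ℝ) :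
    frobNorm (symProd X U) ≤ 2 * specNorm X * frobNorm U := by
  have h1 := frobNorm_mul_le_specNorm X Uᵀ
  have h2 : frobNorm (U * Xᵀ) = frobNorm (X * Uᵀ) := by
    rw [← frobNorm_transpose]; simp
  have h3 := frobNorm_add_le (X * Uᵀ) (U * Xᵀ)
  rw [frobNorm_transpose] at h1
  rw [symProd]
  linarith

/-- Approximate first-order stationarity of the noiseless residual. -/
theorem IsApproxSecondOrder.abs_inner_le
    (h : IsApproxSecondOrder (objective A Mstar w) κ X)
    (hw : ‖(WithLp.toLp 2 ((sensingMatrix A)ᵀ.mulVec w) : EuclideanSpace ℝ (Fin n × Fin n))‖ ≤ ε)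
    (U : Matrix (Fin n) (Fin r) ℝ) :
    |inner ℝ (sensing A (X * Xᵀ - Mstar)) (sensing A (symProd X U))| ≤
      (2 * ε + κ) * specNorm X * frobNorm U := by
  have h1 := abs_le.1 (h.abs_inner_residual_le U)
  have h2 := abs_le.1 (abs_inner_residual_sub_le (Mstar := Mstar) (X := X) hw (symProd X U))
  have h3 : ε * frobNorm (symProd X U) ≤ ε * (2 * specNorm X * frobNorm U) :=
    mul_le_mul_of_nonneg_left (frobNorm_symProd_le X U) ((norm_nonneg _).trans hw)
  exact abs_le.2 ⟨by linarith [h1.1, h2.2], by linarith [h1.2, h2.1]⟩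

/-- The second-order condition along positive semidefinite directions `VVᵀ`. -/
theorem IsApproxSecondOrder.neg_inner_le {g k : ℕ}
    (h : IsApproxSecondOrder (objective A Mstar w) κ X) (hRIP : HasRIP A δ g) (hg : 2 ≤ g)
    (hw : ‖(WithLp.toLp 2 ((sensingMatrix A)ᵀ.mulVec w) : EuclideanSpace ℝ (Fin n × Fin n))‖ ≤ ε)
    {u : Fin r → ℝ} (hu : u ⬝ᵥ u = 1) (V : Matrix (Fin n) (Fin k) ℝ) :
    -inner ℝ (sensing A (X * Xᵀ - Mstar)) (sensing A (V * Vᵀ)) ≤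
      (1 + δ) * ((X.mulVec u ⬝ᵥ X.mulVec u) * frobNorm V ^ 2 +
        ∑ j, (X.mulVec u ⬝ᵥ V.col j) ^ 2) + (ε + κ / 2) * frobNorm V ^ 2 := by
  have h1 := h.psd_direction_nonneg hRIP hg hu V
  have h2 := abs_le.1 (abs_inner_residual_sub_le (Mstar := Mstar) (X := X) hw (V * Vᵀ))
  have h3 : ε * frobNorm (V * Vᵀ) ≤ ε * frobNorm V ^ 2 :=
    mul_le_mul_of_nonneg_left (frobNorm_mul_transpose_le V) ((norm_nonneg _).trans hw)
  linarith [h2.2]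

theorem frobNorm_mul_transpose_le_add (X : Matrix (Fin n) (Fin r) ℝ)
    (M : Matrix (Fin n) (Fin n) ℝ) :
    frobNorm (X * Xᵀ) ≤ frobNorm (X * Xᵀ - M) + frobNorm M := by
  simpa using frobNorm_add_le (X * Xᵀ - M) M

theorem le_quadratic_root {a b c t : ℝ} (ha : 0 < a) (h : a * t ^ 2 ≤ b * t + c) :
    t ≤ (b + Real.sqrt (b ^ 2 + 4 * a * c)) / (2 * a) := by
  rw [le_div_iff₀ (by positivity)]
  have : 2 * a * t - b ≤ Real.sqrt (b ^ 2 + 4 * a * c) :=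
    Real.le_sqrt_of_sq_le (by nlinarith)
  linarith

/-- The error bound when the smallest singular value of `X` is small. -/
theorem frobNorm_sub_le_of_sigma_le (hrstar : 0 < rstar) (hr : rstar ≤ r)
    (hMstar : Mstar.PosSemidef) (hrank : Mstar.rank = rstar) (hRIP : HasRIP A δ (r + rstar))
    (hκ : 0 ≤ κ) (h : IsApproxSecondOrder (objective A Mstar w) κ X)
    (hw : ‖(WithLp.toLp 2 ((sensingMatrix A)ᵀ.mulVec w) : EuclideanSpace ℝ (Fin n × Fin n))‖ ≤ ε)
    (hσ : sigma X r ≤ Real.sqrt ((ε + κ / 2) / (1 + δ))) :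
    frobNorm (X * Xᵀ - Mstar) ≤
      ((ε + κ / 2) * Real.sqrt r +
        Real.sqrt ((ε + κ / 2) ^ 2 * r +
          16 * (1 - δ) * (ε + κ / 2) * Real.sqrt r * frobNorm Mstar)) / (2 * (1 - δ)) := by
  obtain ⟨B, hB⟩ := hMstar.exists_eq_mul_transpose hrank
  obtain ⟨u, hu, hXu⟩ := exists_dotProduct_mulVec_eq_sigma_sq X (hrstar.trans_le hr)
  have hδ0 := hRIP.1
  have hδ1 := hRIP.2.1
  have hε : 0 ≤ ε := (norm_nonneg _).trans hw
  have hη : 0 ≤ ε + κ / 2 := by positivity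
  have hσ2 : (1 + δ) * sigma X r ^ 2 ≤ ε + κ / 2 := by
    have h0 : 0 ≤ sigma X r := LinearMap.singularValues_nonneg _ _
    have h1 := pow_le_pow_left₀ h0 hσ 2
    rw [Real.sq_sqrt (by positivity), le_div_iff₀ (by positivity)] at h1
    linarith
  have h1 : (1 - δ) * frobNorm (X * Xᵀ - Mstar) ^ 2 ≤
      inner ℝ (sensing A (X * Xᵀ - Mstar)) (sensing A (X * Xᵀ - Mstar)) := by
    rw [real_inner_self_eq_norm_sq]
    refine (hRIP.2.2 _ ?_).1
    have := rank_mul_add_mul_le X Xᵀ B (-Bᵀ)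
    rwa [Matrix.mul_neg, ← sub_eq_add_neg, ← hB] at this
  have h2 : inner ℝ (sensing A (X * Xᵀ - Mstar)) (sensing A (X * Xᵀ - Mstar)) =
      inner ℝ (sensing A (X * Xᵀ - Mstar)) (sensing A (X * Xᵀ)) -
        inner ℝ (sensing A (X * Xᵀ - Mstar)) (sensing A Mstar) := by
    rw [← inner_sub_right]
    simp only [← sensingLin_apply, map_sub]
  have h3 : inner ℝ (sensing A (X * Xᵀ - Mstar)) (sensing A (X * Xᵀ)) ≤
      (ε + κ / 2) * frobNorm X ^ 2 := by
    have h4 := (abs_le.1 (h.abs_inner_le hw X)).2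
    rw [symProd_self, ← sensingLin_apply A ((2 : ℝ) • _), map_smul, inner_smul_right,
      sensingLin_apply] at h4
    have h5 : (2 * ε + κ) * specNorm X * frobNorm X ≤ (2 * ε + κ) * frobNorm X * frobNorm X := by
      gcongr
      · exact frobNorm_nonneg X
      · exact specNorm_le_frobNorm X
    linarith
  -- The 3 counts two terms `(1 + δ)σ² ≤ η`, the second arising from Cauchy–Schwarz on `Xu ⬝ᵥ B.col
  -- j`, plus the noise term `η = ε + κ/2`.
  have h4 : -inner ℝ (sensing A (X * Xᵀ - Mstar)) (sensing A Mstar) ≤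
      3 * (ε + κ / 2) * frobNorm B ^ 2 := by
    have h5 := h.neg_inner_le hRIP (by omega) hw hu B
    rw [← hB] at h5
    have h6 : ∑ j, (X.mulVec u ⬝ᵥ B.col j) ^ 2 ≤
        (X.mulVec u ⬝ᵥ X.mulVec u) * frobNorm B ^ 2 := by
      rw [frobNorm_sq_eq_sum_dotProduct, Finset.mul_sum]
      refine Finset.sum_le_sum fun j _ => ?_
      have := Finset.sum_mul_sq_le_sq_mul_sq Finset.univ (X.mulVec u) (B.col j)
      simpa only [dotProduct, ← pow_two] using this
    rw [hXu] at h5 h6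
    have h7 := mul_le_mul_of_nonneg_left h6 (by linarith : 0 ≤ 1 + δ)
    have h8 := mul_le_mul_of_nonneg_right hσ2 (sq_nonneg (frobNorm B))
    linarith
  have h5 : frobNorm B ^ 2 ≤ Real.sqrt r * frobNorm Mstar := by
    rw [hB]
    refine (frobNorm_sq_le_sqrt_mul B).trans (mul_le_mul_of_nonneg_right ?_ (frobNorm_nonneg _))
    exact Real.sqrt_le_sqrt (by exact_mod_cast hr)
  have h6 : frobNorm X ^ 2 ≤
      Real.sqrt r * (frobNorm (X * Xᵀ - Mstar) + frobNorm Mstar) :=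
    (frobNorm_sq_le_sqrt_mul X).trans (mul_le_mul_of_nonneg_left
      (frobNorm_mul_transpose_le_add X Mstar) (Real.sqrt_nonneg _))
  have h7 := mul_le_mul_of_nonneg_left h5 hη
  have h8 := mul_le_mul_of_nonneg_left h6 hη
  -- The constant term collects one `η√r‖M*‖_F` from the `X` bound and three from the `B` bound; the
  -- discriminant's factor 4 turns this into 16.
  have h9 := le_quadratic_root (a := 1 - δ) (b := (ε + κ / 2) * Real.sqrt r)
    (c := 4 * ((ε + κ / 2) * Real.sqrt r * frobNorm Mstar))
    (t := frobNorm (X * Xᵀ - Mstar)) (by linarith) (by linarith)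
  convert h9 using 4
  rw [mul_pow, Real.sq_sqrt (Nat.cast_nonneg r)]
  ring

/-- The final scalar estimate for well-conditioned `X`. -/
theorem gap_mul_le {ρ p q t N b c S T s τ δ : ℝ} (hρ : 0 < ρ) (hδ0 : 0 ≤ δ)
    (hδ : δ * (1 + ρ) < 1) (ht : 0 ≤ t) (hN : 0 ≤ N) (hb : 0 ≤ b)
    (hS : 0 ≤ S) (hT : 0 ≤ T) (hs : 0 ≤ s) (hτ : 0 ≤ τ)
    (hN2 : N ^ 2 = (1 + ρ) ^ 2 * p ^ 2 + b ^ 2 * q ^ 2) (htN : t ^ 2 ≤ N ^ 2)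
    (hcert : (1 + ρ) * b * q ^ 2 - (2 + ρ) * b * s * τ = b ^ 2 * q ^ 2)
    (hlow : (1 + ρ) * p ^ 2 + b * q ^ 2 - δ * (t * N) ≤ c)
    (hup : c ≤ (1 + ρ) * (S * p) + b * ((1 + δ) * s * τ + T * q)) :
    ((1 - δ) / (1 + δ) - ρ / (2 + ρ)) * t ≤ 2 * T + 2 * S := by
  rcases hN.eq_or_lt with h0 | hN
  · have : t = 0 := by
      rw [← h0] at htN
      nlinarith
    rw [this, mul_zero]
    positivity
  have htN' : t ≤ N := (sq_le_sq₀ ht hN.le).1 htN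
  have htN2 : t * N ≤ N ^ 2 := by nlinarith
  set D := (1 + ρ) * p ^ 2 + b * q ^ 2 with hD
  have hDN : (1 + ρ) * D = N ^ 2 + (2 + ρ) * (b * s * τ) := by
    rw [hD, hN2]; linear_combination hcert
  have hbs : 0 ≤ b * s * τ := by positivity
  have hnoise : (1 + ρ) * (S * p) + b * (T * q) ≤ N * (S + T) := by
    have h1 : (1 + ρ) * p ≤ N := by
      refine le_of_sq_le_sq ?_ hN.le
      rw [hN2, mul_pow]
      linarith [mul_nonneg (sq_nonneg b) (sq_nonneg q)]
    have h2 : b * q ≤ N := by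
      refine le_of_sq_le_sq ?_ hN.le
      rw [hN2, mul_pow]
      linarith [mul_nonneg (sq_nonneg (1 + ρ)) (sq_nonneg p)]
    have h3 := mul_le_mul_of_nonneg_left h1 hS
    have h4 := mul_le_mul_of_nonneg_left h2 hT
    linarith
  -- Eliminating `b s τ` via `hDN` leaves the coefficient `(2 + ρ) - (1 + δ)(1 + ρ) = 1 - δ(1 + ρ)`
  -- on `D`, positive by `hδ`; `D` is then replaced using `tN ≤ N² ≤ (1 + ρ)D`.
  have hmain : (1 - δ * (1 + ρ)) * (t * N) ≤ (1 + ρ) * (N * (S + T)) := by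
    have h1 : D - δ * (t * N) ≤ N * (S + T) + (1 + δ) * (b * s * τ) := by linarith
    have h2 : (2 + ρ) * (D - δ * (t * N)) ≤
        (2 + ρ) * (N * (S + T)) + (1 + δ) * ((1 + ρ) * D - N ^ 2) := by
      rw [hDN]
      have := mul_le_mul_of_nonneg_left h1 (by linarith : 0 ≤ 2 + ρ)
      linarith
    have h3 : t * N ≤ (1 + ρ) * D := by
      rw [hDN]
      have : 0 ≤ (2 + ρ) * (b * s * τ) := by positivity
      linarith
    have h4 := mul_le_mul_of_nonneg_left h3 (by linarith : 0 ≤ 1 - δ * (1 + ρ))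
    have h5 := mul_le_mul_of_nonneg_left htN2 (by positivity : 0 ≤ (1 + δ) * (1 + ρ))
    have h6 := mul_le_mul_of_nonneg_left h2 (by linarith : 0 ≤ 1 + ρ)
    have h7 : (2 + ρ) * ((1 - δ * (1 + ρ)) * (t * N)) ≤
        (2 + ρ) * ((1 + ρ) * (N * (S + T))) := by linarith
    exact le_of_mul_le_mul_left h7 (by linarith)
  have hmain2 : (1 - δ * (1 + ρ)) * t ≤ (1 + ρ) * (S + T) := by
    refine le_of_mul_le_mul_left ?_ hN
    linarith
  have hgap : ((1 - δ) / (1 + δ) - ρ / (2 + ρ)) * t =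
      2 * ((1 - δ * (1 + ρ)) * t) / ((1 + δ) * (2 + ρ)) := by
    have : (1 + δ) ≠ 0 := by positivity
    field_simp
    ring
  rw [hgap, div_le_iff₀ (by positivity)]
  have h8 : 0 ≤ (S + T) * (1 + δ * (2 + ρ)) := by positivity
  linarith

/-- The error bound when the smallest singular value of `X` is large. -/
theorem gap_mul_frobNorm_sub_le_of_lt_sigma (hrstar : 0 < rstar) (hr : rstar ≤ r)
    (hMstar : Mstar.PosSemidef) (hrank : Mstar.rank = rstar) (hRIP : HasRIP A δ (r + rstar))
    (hδ : δ < 1 / (1 + Real.sqrt ((rstar : ℝ) / (r : ℝ))))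
    (hκ : 0 ≤ κ) (h : IsApproxSecondOrder (objective A Mstar w) κ X)
    (hw : ‖(WithLp.toLp 2 ((sensingMatrix A)ᵀ.mulVec w) : EuclideanSpace ℝ (Fin n × Fin n))‖ ≤ ε)
    (hσ : Real.sqrt ((ε + κ / 2) / (1 + δ)) < sigma X r) :
    ((1 - δ) / (1 + δ) -
        Real.sqrt ((rstar : ℝ) / (r : ℝ)) / (2 + Real.sqrt ((rstar : ℝ) / (r : ℝ)))) *
        frobNorm (X * Xᵀ - Mstar) ≤
      (2 * ε + κ) * Real.sqrt rstar +
        2 * Real.sqrt ((2 * ε + κ) * (1 + δ)) *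
          (Real.sqrt (frobNorm (X * Xᵀ - Mstar)) + Real.sqrt (frobNorm Mstar)) := by
  obtain ⟨B, hB⟩ := hMstar.exists_eq_mul_transpose hrank
  have hr0 : 0 < r := hrstar.trans_le hr
  have hr0' : (0 : ℝ) < r := by exact_mod_cast hr0
  have hrs0' : (0 : ℝ) < rstar := by exact_mod_cast hrstar
  have hr' : (rstar : ℝ) ≤ r := by exact_mod_cast hr
  obtain ⟨u, hu, hXu⟩ := exists_dotProduct_mulVec_eq_sigma_sq X hr0
  have hδ0 := hRIP.1
  have hε : 0 ≤ ε := (norm_nonneg _).trans hw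
  have hη : 0 ≤ ε + κ / 2 := by positivity
  have hσ0 : 0 < sigma X r := (Real.sqrt_nonneg _).trans_lt hσ
  have hσ2 : ε + κ / 2 ≤ (1 + δ) * sigma X r ^ 2 := by
    have h1 := pow_le_pow_left₀ (Real.sqrt_nonneg _) hσ.le 2
    rw [Real.sq_sqrt (by positivity), div_le_iff₀ (by positivity)] at h1
    linarith
  obtain ⟨Y, hYX, hP⟩ := exists_left_inverse hr0 hσ0
  obtain ⟨V, hV⟩ : ∃ V, V = (1 - X * Y) * B := ⟨_, rfl⟩
  have hE : (X * Xᵀ - Mstar)ᵀ = X * Xᵀ - Mstar := by simp [hB]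
  have hT : X * Xᵀ - Mstar + V * Vᵀ =
      (X * Xᵀ - Mstar) - (1 - X * Y) * (X * Xᵀ - Mstar) * (1 - X * Y) := by
    rw [hB, compl_block_residual hYX hP, hV, sub_neg_eq_add]
  obtain ⟨U, hU, hUnorm⟩ := exists_symProd_eq hr0 hYX hP hE
  rw [← hT] at hU hUnorm
  set E := X * Xᵀ - Mstar with hEdef
  set W := V * Vᵀ with hW
  set F := E + W with hF
  have hFW : frobInner F W = 0 := by
    rw [hF, hEdef, hB]; exact frobInner_tangent_compl_eq_zero hYX hP hV
  have hEF : E = F + (-1 : ℝ) • W := by rw [hF]; module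
  set ρ := Real.sqrt ((rstar : ℝ) / (r : ℝ)) with hρdef
  have hρ : 0 < ρ := Real.sqrt_pos.2 (by positivity)
  have hρ2 : ρ ^ 2 * r = rstar := by
    rw [hρdef, Real.sq_sqrt (by positivity)]; field_simp
  have hρ1 : ρ ≤ 1 := Real.sqrt_le_one.2 ((div_le_one hr0').2 hr')
  have hδρ : δ * (1 + ρ) < 1 := by rwa [lt_div_iff₀ (by positivity)] at hδ
  have hτ : frobNorm V ^ 2 ≤ Real.sqrt rstar * frobNorm W := frobNorm_sq_le_sqrt_mul V
  obtain ⟨b, hb, hnorm, hcert⟩ := exists_certificate_coeff (p := frobNorm F) (q := frobNorm W)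
    (τ := frobNorm V ^ 2) (s := sigma X r ^ 2) (frobNorm_nonneg W) (sq_nonneg _) (sq_nonneg _)
    hρ hρ1 hρ2 hrs0'.le hτ (fun c hc => by
      have := le_frobNorm_tangent_sq hr0 hYX hP hc hV
      rw [← hB] at this
      rw [← pow_mul]
      exact this)
  obtain ⟨D, hD⟩ : ∃ D, D = (1 + ρ) • F + (-b) • W := ⟨_, rfl⟩
  have hE2 : frobNorm E ^ 2 = frobNorm F ^ 2 + frobNorm W ^ 2 := by
    rw [hEF, frobNorm_add_sq, frobInner_smul_right, hFW, frobNorm_smul_sq]; ring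
  have hD2 : frobNorm D ^ 2 = (1 + ρ) ^ 2 * frobNorm F ^ 2 + b ^ 2 * frobNorm W ^ 2 := by
    rw [hD, frobNorm_add_sq, frobInner_smul_right, frobInner_smul_left, hFW, frobNorm_smul_sq,
      frobNorm_smul_sq]
    ring
  have hED : frobInner E D = (1 + ρ) * frobNorm F ^ 2 + b * frobNorm W ^ 2 := by
    rw [hEF, hD]
    simp only [frobInner_add_left, frobInner_add_right, frobInner_smul_left,
      frobInner_smul_right, frobInner_comm W F, hFW, frobInner_self]
    ring
  -- `W` differs from `BVᵀ` by a matrix with columns in the range of `X`. All combinations of `E`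
  -- and `D` thus have columns in the span of those of `X` and `B`, so their rank is at most `r +
  -- r*`.
  have hlow := hRIP.le_inner (M := E) (N := D) (fun a c => by
    have h1 : W = (V - B) * Vᵀ + B * Vᵀ := by rw [hW, Matrix.sub_mul, sub_add_cancel]
    have h2 : V - B = X * (-(Y * B)) := by
      rw [hV, Matrix.sub_mul, Matrix.one_mul, Matrix.mul_neg, Matrix.mul_assoc]; abel
    have h3 : a • E + c • D = X * ((a + c * (1 + ρ)) • Xᵀ +
        (c * (1 + ρ) - c * b) • (-(Y * B) * Vᵀ)) +
        B * ((-(a + c * (1 + ρ))) • Bᵀ + (c * (1 + ρ) - c * b) • Vᵀ) := by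
      simp only [Matrix.mul_add, Matrix.mul_smul]
      rw [← Matrix.mul_assoc X (-(Y * B)), ← h2, hD, hF, h1, hEdef, hB]
      module
    rw [h3]
    exact rank_mul_add_mul_le _ _ _ _)
  rw [hED] at hlow
  have hfirst : inner ℝ (sensing A E) (sensing A F) ≤
      Real.sqrt ((2 * ε + κ) * (1 + δ)) * specNorm X * frobNorm F := by
    have h1 := (abs_le.1 (h.abs_inner_le hw U)).2
    rw [hU] at h1
    refine h1.trans ?_
    -- This is where large `σ` is used: `2η‖U‖² ≤ 2(1 + δ)σ²‖U‖² ≤ (1 + δ)‖F‖²`.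
    have h2 : (2 * ε + κ) * frobNorm U ≤
        Real.sqrt ((2 * ε + κ) * (1 + δ)) * frobNorm F := by
      refine le_of_sq_le_sq ?_ (mul_nonneg (Real.sqrt_nonneg _) (frobNorm_nonneg _))
      rw [mul_pow, mul_pow, Real.sq_sqrt (by positivity)]
      have h3 : (2 * ε + κ) * frobNorm U ^ 2 ≤ (1 + δ) * frobNorm F ^ 2 := by
        have h4 := mul_le_mul_of_nonneg_left hUnorm (by linarith : 0 ≤ 1 + δ)
        have h5 := mul_le_mul_of_nonneg_right hσ2 (sq_nonneg (frobNorm U))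
        linarith
      have := mul_le_mul_of_nonneg_left h3 (by positivity : 0 ≤ 2 * ε + κ)
      linarith
    have := mul_le_mul_of_nonneg_left h2 (specNorm_nonneg X)
    linarith
  have hsecond : -inner ℝ (sensing A E) (sensing A W) ≤
      (1 + δ) * sigma X r ^ 2 * frobNorm V ^ 2 +
        (ε + κ / 2) * Real.sqrt rstar * frobNorm W := by
    have h1 := h.neg_inner_le hRIP (by omega) hw hu V
    -- The columns of `V` are orthogonal to the range of `X`, so the extra curvature term present in
    -- the small-`σ` case vanishes.
    have h2 : ∀ j, X.mulVec u ⬝ᵥ V.col j = 0 := by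
      intro j
      have h3 : vecMul (X.mulVec u) V = 0 := by
        rw [← vecMul_transpose, vecMul_vecMul, hV, ← Matrix.mul_assoc, transpose_mul_compl hYX hP,
          Matrix.zero_mul, vecMul_zero]
      exact congrFun h3 j
    simp only [h2, hXu] at h1
    have h4 := mul_le_mul_of_nonneg_left hτ hη
    simp only [ne_eq, OfNat.ofNat_ne_zero, not_false_eq_true, zero_pow, Finset.sum_const_zero,
      add_zero] at h1
    linarith
  have hup : inner ℝ (sensing A E) (sensing A D) ≤
      (1 + ρ) * (Real.sqrt ((2 * ε + κ) * (1 + δ)) * specNorm X * frobNorm F) +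
        b * ((1 + δ) * sigma X r ^ 2 * frobNorm V ^ 2 +
          (ε + κ / 2) * Real.sqrt rstar * frobNorm W) := by
    have h1 : inner ℝ (sensing A E) (sensing A D) =
        (1 + ρ) * inner ℝ (sensing A E) (sensing A F) +
          b * -inner ℝ (sensing A E) (sensing A W) := by
      rw [hD]
      simp only [← sensingLin_apply, map_add, map_smul, inner_add_right, inner_smul_right]
      ring
    rw [h1]
    exact add_le_add (mul_le_mul_of_nonneg_left hfirst (by linarith))
      (mul_le_mul_of_nonneg_left hsecond hb)
  have hgap := gap_mul_le (t := frobNorm E) hρ hδ0 hδρ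
    (frobNorm_nonneg E) (frobNorm_nonneg D) hb
    (mul_nonneg (Real.sqrt_nonneg ((2 * ε + κ) * (1 + δ))) (specNorm_nonneg X))
    (mul_nonneg hη (Real.sqrt_nonneg rstar)) (sq_nonneg (sigma X r)) (sq_nonneg (frobNorm V))
    hD2 (by rw [hE2, hD2]; exact hnorm) hcert hlow hup
  have hspec : specNorm X ≤ Real.sqrt (frobNorm E) + Real.sqrt (frobNorm Mstar) := by
    refine le_of_sq_le_sq ?_ (by positivity)
    rw [add_sq, Real.sq_sqrt (frobNorm_nonneg _), Real.sq_sqrt (frobNorm_nonneg _)]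
    have h1 := specNorm_sq_le X
    have h2 := frobNorm_mul_transpose_le_add X Mstar
    have h3 : 0 ≤ 2 * Real.sqrt (frobNorm E) * Real.sqrt (frobNorm Mstar) := by positivity
    linarith
  have := mul_le_mul_of_nonneg_left hspec (Real.sqrt_nonneg ((2 * ε + κ) * (1 + δ)))
  linarith

end Recovery

end MatrixSensing

/-! ### The probabilistic statement -/

theorem theorem5 {Ω : Type*} [MeasurableSpace Ω] (μ : Measure Ω) [IsProbabilityMeasure μ]
    {m n r rstar : ℕ} (hrstar : 0 < rstar) (hr : rstar ≤ r)
    (A : Fin m → Matrix (Fin n) (Fin n) ℝ)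
    (Mstar : Matrix (Fin n) (Fin n) ℝ) (hMstar : Mstar.PosSemidef) (hrank : Mstar.rank = rstar)
    (w : Ω → EuclideanSpace ℝ (Fin m)) (hw : Measurable w)
    (δ : ℝ) (hRIP : MatrixSensing.HasRIP A δ (r + rstar))
    (hδ : δ < 1 / (1 + Real.sqrt ((rstar : ℝ) / (r : ℝ))))
    (ε κ : ℝ) (hε : 0 < ε) (hκ : 0 ≤ κ) :
    ∃ E : Set Ω, MeasurableSet E ∧
      μ {ω | ‖WithLp.toLp 2 ((MatrixSensing.sensingMatrix A).transpose.mulVec (w ω))‖ ≤ ε} ≤ μ E ∧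
      ∀ ω ∈ E, ∀ X : Matrix (Fin n) (Fin r) ℝ,
        MatrixSensing.IsApproxSecondOrder (MatrixSensing.objective A Mstar (w ω)) κ X →
        (MatrixSensing.sigma X r ≤ Real.sqrt ((ε + κ / 2) / (1 + δ)) →
          MatrixSensing.frobNorm (X * X.transpose - Mstar) ≤
            ((ε + κ / 2) * Real.sqrt r +
              Real.sqrt ((ε + κ / 2) ^ 2 * r +
                16 * (1 - δ) * (ε + κ / 2) * Real.sqrt r * MatrixSensing.frobNorm Mstar)) /
              (2 * (1 - δ))) ∧
        (Real.sqrt ((ε + κ / 2) / (1 + δ)) < MatrixSensing.sigma X r →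
          ((1 - δ) / (1 + δ) -
              Real.sqrt ((rstar : ℝ) / (r : ℝ)) / (2 + Real.sqrt ((rstar : ℝ) / (r : ℝ)))) *
              MatrixSensing.frobNorm (X * X.transpose - Mstar) ≤
            (2 * ε + κ) * Real.sqrt rstar +
              2 * Real.sqrt ((2 * ε + κ) * (1 + δ)) *
                (Real.sqrt (MatrixSensing.frobNorm (X * X.transpose - Mstar)) +
                  Real.sqrt (MatrixSensing.frobNorm Mstar))) := by
  refine ⟨{ω | ‖WithLp.toLp 2 ((MatrixSensing.sensingMatrix A).transpose.mulVec (w ω))‖ ≤ ε},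
    measurableSet_le ?_ measurable_const, le_rfl, fun ω hω X hX => ⟨fun hσ => ?_, fun hσ => ?_⟩⟩
  · have hc : Continuous fun x : EuclideanSpace ℝ (Fin m) =>
        ‖WithLp.toLp 2 ((MatrixSensing.sensingMatrix A).transpose.mulVec x.ofLp)‖ := by fun_prop
    exact hc.measurable.comp hw
  · exact MatrixSensing.frobNorm_sub_le_of_sigma_le hrstar hr hMstar hrank hRIP hκ hX hω hσ
  · exact MatrixSensing.gap_mul_frobNorm_sub_le_of_lt_sigma hrstar hr hMstar hrank hRIP hδ hκ hX
      hω hσ
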